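/- **Setting** (units $\hbar=k_B=1$). A quantum system with finite-dimensional Hilbert space performs a cyclic protocol in time $\tau$. In rescaled time $s=t/\tau$ the protocol is fixed: a $1$-periodic $C^1$ Hamiltonian $\hat H_s$, $1$-periodic continuous jump operators $\hat L_k(s)$ (finitely many), and a bath temperature $\hat T_s=T_cT_h/[T_h+\alpha_s(T_c-T_h)]$ with $0<T_c<T_h$ and $\alpha$ a $1$-periodic $C^1$ function with $\min\alpha=0$, $\max\alpha=1$. The jumps come in pairs $(k,k')$ with real $\omega_k(s)=-\omega_{k'}(s)$ such that $[\hat L_k(s),\hat H_s]=\omega_k(s)\hat L_k(s)$ and (local detailed balance) $\hat L_k(s)=e^{\omega_k(s)/(2\hat T_s)}\hat L_{k'}(s)^\dagger$. For every $\tau>0$ let $\varrho^\tau$ be a $\tau$-periodic curve of density matrices that solves the Lindblad equation $$\dot\varrho_t=-i[H_t,\varrho_t]+\sum_k\Big(L_k(t)\varrho_tL_k(t)^\dagger-\tfrac12\{L_k(t)^\dagger L_k(t),\varrho_t\}\Big),\qquad H_t=\hat H_{t/\tau},\; L_k(t)=\hat L_k(t/\tau).$$ With $\alpha_t:=\alpha_{s}|_{s=t/\tau}$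 put $P_w=-\tau^{-1}\int_0^\tau\mathrm{tr}(\dot H_t\varrho^\tau_t)\,dt$, $J_q=\tau^{-1}\int_0^\tau\alpha_t\,\mathrm{tr}(H_t\dot\varrho^\tau_t)\,dt$, $\eta_\tau=P_w/J_q$ and $\eta_C=1-T_c/T_h$. **Quasistatic quantities.** Let $\pi_s=e^{-\hat H_s/\hat T_s}/\mathrm{tr}\,e^{-\hat H_s/\hat T_s}$ and $$\mathcal W=\int_0^1\mathrm{tr}(\hat H_s\dot\pi_s)\,ds,\qquad \bar a^\infty=\int_0^1\sum_k\mathrm{tr}\big(\hat L_k(s)\pi_s\hat L_k(s)^\dagger\big)ds,\qquad \ell_W^\infty=\lim_{N\to\infty}\sum_{k=0}^{N-1}W(\pi_{k/N},\pi_{(k+1)/N}),$$ where $W(\varrho,\sigma)=\frac12\sum_n|a_n-b_n|$ for the increasingly ordered eigenvalues $(a_n)$ of $\varrho$ and $(b_n)$ of $\sigma$. **Assumption (perturbative form).** Uniformly in $s\in[0,1]$, as $\tau\to\infty$, $\varrho^\tau_{\tau s}=\pi_s+\tau^{-1}\hat\varrho_{1,s}+O(\tau^{-2})$ for some $\hat\varrho_{1,s}$.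 Moreover, for all large $\tau$, $\varrho^\tau_{\tau s}$ has an orthonormal basis of eigenvectors, continuous in $s\in[0,1]$, and corresponding eigenvalues that equal, up to $O(\tau^{-1})$ uniformly in $s$, an orthonormal basis of eigenvectors of $\pi_s$ and its corresponding eigenvalues. **Claim.** If $\mathcal W>0$, then $\bar a^\infty>0$, the limit $\ell_W^\infty$ exists, $J_q>0$ for all large $\tau$, and, as $\tau\to\infty$, $$\eta_\tau\le\eta_C\Big(1-\frac{2T_c}{\bar a^\infty}\,\frac{(\ell_W^\infty)^2}{\mathcal W\,\tau}\Big)+O(\tau^{-2}),$$ that is, there are $C$ and $\tau_1>0$ such that for all $\tau\ge\tau_1$ the inequality holds with $C/\tau^2$ in place of $O(\tau^{-2})$. -/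

import Mathlib

open Filter Topology MeasureTheory
open scoped Matrix ComplexOrder Matrix.Norms.Frobenius

noncomputable section

namespace HeatEngine

/-! ### Lindblad dynamics (units with `ħ = k_B = 1`) -/

/-- The dissipator `𝓓[L]ρ = L ρ L† - {L† L, ρ} / 2`. -/
def dissipator {n : Type*} [Fintype n] (L ρ : Matrix n n ℂ) : Matrix n n ℂ :=
  L * ρ * Lᴴ - (1 / 2 : ℂ) • (Lᴴ * L * ρ + ρ * (Lᴴ * L))

/-- The Lindblad generator `ρ ↦ -i [H, ρ] + ∑ₖ 𝓓[Lₖ]ρ`. -/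
def lindbladian {n K : Type*} [Fintype n] [Fintype K]
    (H : Matrix n n ℂ) (L : K → Matrix n n ℂ) (ρ : Matrix n n ℂ) : Matrix n n ℂ :=
  (-Complex.I) • (H * ρ - ρ * H) + ∑ k, dissipator (L k) ρ

/-- The Gibbs state `e^{-H/T} / tr e^{-H/T}`. -/
def gibbs {n : Type*} [Fintype n] [DecidableEq n] (H : Matrix n n ℂ) (T : ℝ) : Matrix n n ℂ :=
  (NormedSpace.exp (-(T⁻¹ • H))).trace⁻¹ • NormedSpace.exp (-(T⁻¹ • H))

/-! ### Protocols -/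

/-- A cyclic reference protocol of a heat engine, in rescaled time (one cycle has length `1`):
Hamiltonian `H`, jump operators `L k`, and modulation `α` of the bath temperature between
`Tc` and `Th`, subject to local detailed balance. -/
structure Protocol (n K : Type*) [Fintype n] [DecidableEq n] [Fintype K] where
  /-- minimal bath temperature -/
  Tc : ℝ
  /-- maximal bath temperature -/
  Th : ℝ
  /-- temperature modulation -/
  α : ℝ → ℝ
  /-- Hamiltonian -/
  H : ℝ → Matrix n n ℂ
  /-- jump operators -/
  L : K → ℝ → Matrix n n ℂ
  /-- the pairing `k ↦ k'` of the jumps -/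
  pair : K → K
  /-- energy released by the system in the `k`-th jump -/
  ω : K → ℝ → ℝ
  Tc_pos : 0 < Tc
  Tc_lt_Th : Tc < Th
  α_contDiff : ContDiff ℝ 1 α
  α_periodic : Function.Periodic α 1
  α_min : IsLeast (Set.range α) 0
  α_max : IsGreatest (Set.range α) 1
  H_contDiff : ContDiff ℝ 1 H
  H_periodic : Function.Periodic H 1
  H_hermitian : ∀ s, (H s).IsHermitian
  L_continuous : ∀ k, Continuous (L k)
  L_periodic : ∀ k, Function.Periodic (L k) 1
  pair_involutive : Function.Involutive pair
  ω_pair : ∀ k s, ω (pair k) s = -ω k s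
  /-- the `k`-th jump changes the energy by the definite amount `ω k` -/
  energy_change : ∀ k s, L k s * H s - H s * L k s = ω k s • L k s
  /-- local detailed balance `Lₖ = e^{β ωₖ / 2} L_{k'}†`, where
  `1 / β = Tc Th / (Th + α (Tc - Th))` is the bath temperature -/
  detailed_balance : ∀ k s,
    L k s = Real.exp ((Tc * Th / (Th + α s * (Tc - Th)))⁻¹ * ω k s / 2) • (L (pair k) s)ᴴ

namespace Protocol

variable {n K : Type*} [Fintype n] [DecidableEq n] [Fintype K]

/-- The bath temperature `Tc Th / (Th + α (Tc - Th))`. -/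
def temp (P : Protocol n K) (s : ℝ) : ℝ :=
  P.Tc * P.Th / (P.Th + P.α s * (P.Tc - P.Th))

/-- The Carnot efficiency. -/
def carnot (P : Protocol n K) : ℝ := 1 - P.Tc / P.Th

/-- The instantaneous Gibbs state along the reference protocol. -/
def gibbsPath (P : Protocol n K) (s : ℝ) : Matrix n n ℂ := gibbs (P.H s) (P.temp s)

/-- `ρ` is a cyclic state of the engine that performs the protocol `P` in time `τ`: a
`τ`-periodic curve of density matrices that solves the Lindblad equation with
`H_t = H(t/τ)` and `L_k(t) = L_k(t/τ)`. -/
structure IsCyclicState (P : Protocol n K) (τ : ℝ) (ρ : ℝ → Matrix n n ℂ) : Prop where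
  posSemidef : ∀ t, (ρ t).PosSemidef
  trace_eq_one : ∀ t, (ρ t).trace = 1
  periodic : Function.Periodic ρ τ
  lindblad : ∀ t,
    HasDerivAt ρ (lindbladian (P.H (t / τ)) (fun k => P.L k (t / τ)) (ρ t)) t

end Protocol

/-! ### Thermodynamic quantities -/

section Quantities

variable {n K : Type*} [Fintype n] [Fintype K]

/-- Work power `-τ⁻¹ ∫₀^τ tr(Ḣ_t ρ_t) dt`. -/
def workPower (τ : ℝ) (H ρ : ℝ → Matrix n n ℂ) : ℝ :=
  -τ⁻¹ * ∫ t in (0 : ℝ)..τ, ((deriv H t * ρ t).trace).re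

/-- Rate of absorbed heat `tr(H_t ρ̇_t)`. -/
def heatRate (H ρ : ℝ → Matrix n n ℂ) (t : ℝ) : ℝ := ((H t * deriv ρ t).trace).re

/-- Time-averaged heat supply `τ⁻¹ ∫₀^τ α_t tr(H_t ρ̇_t) dt`. -/
def heatSupply (τ : ℝ) (α : ℝ → ℝ) (H ρ : ℝ → Matrix n n ℂ) : ℝ :=
  τ⁻¹ * ∫ t in (0 : ℝ)..τ, α t * heatRate H ρ t

/-- Dynamical activity `τ⁻¹ ∫₀^τ ∑ₖ tr(L_k ρ_t L_k†) dt`. -/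
def activity (τ : ℝ) (L : K → ℝ → Matrix n n ℂ) (ρ : ℝ → Matrix n n ℂ) : ℝ :=
  τ⁻¹ * ∫ t in (0 : ℝ)..τ, ∑ k, ((L k t * ρ t * (L k t)ᴴ).trace).re

end Quantities

section Length

variable {n : Type*} [Fintype n] [DecidableEq n]

/-- Eigenvalues of a Hermitian matrix with multiplicity, in monotone order (`0` if the matrix is
not Hermitian). -/
def sortedEigenvalues (A : Matrix n n ℂ) : Fin (Fintype.card n) → ℝ :=
  open Classical in if h : A.IsHermitian then h.eigenvalues₀ else 0

/-- Quantum Wasserstein distance `½ ∑ |aₙ - bₙ|` between the ordered spectra. -/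
def wasserstein (ρ σ : Matrix n n ℂ) : ℝ :=
  (1 / 2) * ∑ i, |sortedEigenvalues ρ i - sortedEigenvalues σ i|

/-- `ℓ` is the geometric length of `γ` on `[0, τ]` for the distance `d`: the limit of
`∑_{k<N} d(γ(kδ), γ((k+1)δ))` with `δ = τ/N → 0`. -/
def IsGeometricLength (d : Matrix n n ℂ → Matrix n n ℂ → ℝ) (τ : ℝ) (γ : ℝ → Matrix n n ℂ)
    (ℓ : ℝ) : Prop :=
  Tendsto (fun N : ℕ => ∑ k ∈ Finset.range N,
    d (γ (k * (τ / N))) (γ ((k + 1) * (τ / N)))) atTop (𝓝 ℓ)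

end Length

namespace Protocol

variable {n K : Type*} [Fintype n] [DecidableEq n] [Fintype K]

/-- Heat supply `J_q` of the engine that performs the protocol in time `τ` in the state `ρ`. -/
def meanHeat (P : Protocol n K) (τ : ℝ) (ρ : ℝ → Matrix n n ℂ) : ℝ :=
  heatSupply τ (fun t => P.α (t / τ)) (fun t => P.H (t / τ)) ρ

/-- Efficiency `P_w / J_q` of the engine that performs the protocol in time `τ` in the
state `ρ`. -/
def efficiency (P : Protocol n K) (τ : ℝ) (ρ : ℝ → Matrix n n ℂ) : ℝ :=
  workPower τ (fun t => P.H (t / τ)) ρ / P.meanHeat τ ρ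

/-- Quasistatic work `∫₀¹ tr(H π̇) ds`, where `π` is the Gibbs path. -/
def quasistaticWork (P : Protocol n K) : ℝ :=
  ∫ s in (0 : ℝ)..1, heatRate P.H P.gibbsPath s

/-- Quasistatic dynamical activity `∫₀¹ ∑ₖ tr(L_k π L_k†) ds`, where `π` is the Gibbs path. -/
def quasistaticActivity (P : Protocol n K) : ℝ := activity 1 P.L P.gibbsPath

end Protocol

/-! ### Perturbative expansions in `1/τ` -/

/-- `f_τ(s) = ∑_{k ≤ N} τ^{-k} c_k(s) + O(τ^{-(N+1)})` as `τ → ∞`, uniformly in `s ∈ [0, 1]`. -/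
def HasExpansion {E : Type*} [NormedAddCommGroup E] [NormedSpace ℝ E] (N : ℕ)
    (f : ℝ → ℝ → E) (c : ℕ → ℝ → E) : Prop :=
  ∃ C τ₀ : ℝ, 0 < τ₀ ∧ ∀ τ, τ₀ ≤ τ → ∀ s ∈ Set.Icc (0 : ℝ) 1,
    ‖f τ s - ∑ k ∈ Finset.range (N + 1), (τ ^ k)⁻¹ • c k s‖ ≤ C / τ ^ (N + 1)

/-- `A s = U s diag(p s) (U s)†` on `[0, 1]` with `U s` unitary: `p s` lists the eigenvalues of
`A s`, and the columns of `U s` are orthonormal eigenvectors. -/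
def IsEigenDecomposition {n : Type*} [Fintype n] [DecidableEq n]
    (A : ℝ → Matrix n n ℂ) (p : ℝ → n → ℝ) (U : ℝ → Matrix n n ℂ) : Prop :=
  ∀ s ∈ Set.Icc (0 : ℝ) 1, U s ∈ Matrix.unitaryGroup n ℂ ∧
    A s = U s * Matrix.diagonal (fun i => (p s i : ℂ)) * (U s)ᴴ

/-- The perturbative assumption on a family `ρ τ` of cyclic states with periods `τ`, for the
rescaled states `ρ τ (τ s)`, `0 ≤ s ≤ 1`. -/
structure Protocol.HasPerturbativeForm {n K : Type*} [Fintype n] [DecidableEq n] [Fintype K]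
    (P : Protocol n K) (ρ : ℝ → ℝ → Matrix n n ℂ) : Prop where
  /-- The rescaled state is `π + τ⁻¹ ρ₁ + O(τ⁻²)`, where `π` is the Gibbs path. -/
  state : ∃ c : ℕ → ℝ → Matrix n n ℂ, (∀ s ∈ Set.Icc (0 : ℝ) 1, c 0 s = P.gibbsPath s) ∧
    HasExpansion 1 (fun τ s => ρ τ (τ * s)) c
  /-- For large `τ` the rescaled state has eigenvalues `p τ s` and eigenvectors (columns of
  `U τ s`, continuous in `s`) that are `O(τ⁻¹)`-close to those of the Gibbs path. -/
  eigen : ∃ (p : ℝ → ℝ → n → ℝ) (U : ℝ → ℝ → Matrix n n ℂ)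
      (p' : ℕ → ℝ → n → ℝ) (U' : ℕ → ℝ → Matrix n n ℂ),
    (∀ᶠ τ in atTop, IsEigenDecomposition (fun s => ρ τ (τ * s)) (p τ) (U τ) ∧
      ContinuousOn (U τ) (Set.Icc 0 1)) ∧
    IsEigenDecomposition P.gibbsPath (p' 0) (U' 0) ∧
    HasExpansion 0 p p' ∧ HasExpansion 0 U U'

end HeatEngine

end

/-!
The mechanism is a speed limit. In an orthonormal eigenbasis of a solution `ρ` of the Lindblad
equation, the eigenvalues `p` of `ρ` follow a classical jump process whose rates inherit local
detailed balance (`lindbladian_populations`). For such a process the elementary bound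
`2 (y - 1)² ≤ (y + 1) (y - 1) log y`, applied to the ratio `y` of each pair of opposite fluxes,
gives `(½ ∑ |ṗ|)² ≤ ½ A σ`, with `A` the dynamical activity and `σ` the entropy production rate.
It is used in the linearised form `x ∑ |ṗ| - x² A / 2 ≤ σ` for all `x ≥ 0`
(`lindbladian_speed_limit`): this form can be integrated over a cycle without a Cauchy–Schwarz
argument, and it keeps all error terms linear (`Protocol.IsCyclicState.cycle_speed_limit`). Over a
cycle the entropy of the system returns to its initial value, so what remains of `σ` is the heat
divided by the temperature. Together with the first law this is Carnot's relation
`η_C J_q = P_w + T_c σ̄`, with `σ̄` the mean entropy production rate.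

The bound requires the total motion `∫ ∑ |ṗ|` of the spectrum of `ρ^τ` to agree with that of the
Gibbs path `π` up to `O(1/τ)`, which closeness of the curves alone does not provide. Here the
dynamics helps: `π` is stationary for the instantaneous generator, so the generator applied to
`τ (ρ^τ - π)` is exactly the rescaled velocity of `ρ^τ`, and this converges uniformly at rate `1/τ`,
necessarily to the velocity of `π` (`Protocol.exists_uniformApprox`). As the eigenvectors converge
at the same rate and are continuous, the Hellmann–Feynman formula
(`IsEigenDecomposition.hasDerivAt`) turns this into convergence of the velocities of the
eigenvalues.

The length `ℓ` exists because the ordered eigenvalues of `π` are Lipschitz and uniform partitions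
exhaust the variation of a continuous function (`tendsto_sum_edist_uniform_partition`); it is at
most `½ ∫ ∑ |ṗ|` because ordering two spectra minimises their `ℓ¹` distance (`wasserstein_le`).
The activity is positive since without jumps there would be no heat exchange, hence no work.
-/

noncomputable section

namespace HeatEngine

/-! ### Length along uniform partitions -/

/-- For a continuous function, uniform partitions already exhaust the variation: the step functions
that interpolate `f` on the grid converge to `f`, and the variation is lower semicontinuous. -/
theorem tendsto_sum_edist_uniform_partition {f : ℝ → ℝ} (hf : ContinuousOn f (Set.Icc 0 1)) :
    Tendsto (fun N : ℕ => ∑ k ∈ Finset.range N,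
      edist (f (k * (1 / N))) (f ((k + 1) * (1 / N)))) atTop
      (𝓝 (eVariationOn f (Set.Icc 0 1))) := by
  have hmono : ∀ N : ℕ, Monotone (fun k : ℕ => (k : ℝ) * (1 / N)) := by
    intro N a b hab
    have : (a : ℝ) ≤ b := by exact_mod_cast hab
    dsimp only
    gcongr
  have hgrid : ∀ N : ℕ, eVariationOn f ((fun k : ℕ => (k : ℝ) * (1 / N)) '' Set.Iic N) =
      ∑ k ∈ Finset.range N, edist (f (k * (1 / N))) (f ((k + 1) * (1 / N))) := by
    intro N
    rw [eVariationOn.image_range_of_monotone f (hmono N) N]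
    push_cast
    rfl
  simp_rw [← hgrid]
  rw [tendsto_order]
  constructor
  · intro v hv
    have hφ : ∀ x ∈ Set.Icc (0 : ℝ) 1,
        Tendsto (fun N : ℕ => (⌊x * N⌋₊ : ℝ) / N) atTop (𝓝 x) := fun x hx =>
      (tendsto_nat_floor_mul_div_atTop hx.1).comp tendsto_natCast_atTop_atTop
    have hmem : ∀ x ∈ Set.Icc (0 : ℝ) 1, ∀ N : ℕ, ⌊x * N⌋₊ ≤ N := by
      intro x hx N
      refine Nat.floor_le_of_le ?_
      exact mul_le_of_le_one_left (Nat.cast_nonneg N) hx.2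
    have hIcc : ∀ x ∈ Set.Icc (0 : ℝ) 1, ∀ N : ℕ, (⌊x * N⌋₊ : ℝ) / N ∈ Set.Icc (0 : ℝ) 1 := by
      intro x hx N
      refine ⟨by positivity, div_le_one_of_le₀ ?_ (Nat.cast_nonneg N)⟩
      exact_mod_cast hmem x hx N
    have hlim : ∀ x ∈ Set.Icc (0 : ℝ) 1,
        Tendsto (fun N : ℕ => (f ∘ fun y : ℝ => (⌊y * (N : ℝ)⌋₊ : ℝ) / N) x) atTop (𝓝 (f x)) := by
      intro x hx
      refine Tendsto.comp (hf x hx) (tendsto_nhdsWithin_iff.2 ⟨hφ x hx, ?_⟩)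
      exact Eventually.of_forall fun N => hIcc x hx N
    filter_upwards [eVariationOn.lowerSemicontinuous_aux hlim hv] with N hN
    refine hN.trans_le (eVariationOn.comp_le_of_monotoneOn f _ ?_ ?_)
    · intro x _ y _ hxy
      dsimp only
      gcongr
    · intro x hx
      exact ⟨⌊x * N⌋₊, hmem x hx N, by dsimp only; ring⟩
  · intro v hv
    filter_upwards [eventually_gt_atTop 0] with N hN
    refine (eVariationOn.mono f ?_).trans_lt hv
    rintro _ ⟨k, hk, rfl⟩
    have hN' : (0 : ℝ) < N := by exact_mod_cast hN
    have hk' : (k : ℝ) ≤ N := by exact_mod_cast hk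
    refine ⟨by positivity, ?_⟩
    dsimp only
    rw [mul_one_div]
    exact (div_le_one hN').2 hk'

theorem tendsto_sum_abs_uniform_partition {f : ℝ → ℝ} (hf : ContinuousOn f (Set.Icc 0 1))
    (hbv : BoundedVariationOn f (Set.Icc 0 1)) :
    Tendsto (fun N : ℕ => ∑ k ∈ Finset.range N,
      |f (k * (1 / N)) - f ((k + 1) * (1 / N))|) atTop
      (𝓝 (eVariationOn f (Set.Icc 0 1)).toReal) := by
  have h := (ENNReal.tendsto_toReal hbv).comp (tendsto_sum_edist_uniform_partition hf)
  refine h.congr fun N => ?_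
  simp only [Function.comp_apply]
  rw [ENNReal.toReal_sum (fun _ _ => edist_ne_top _ _)]
  refine Finset.sum_congr rfl fun k _ => ?_
  rw [edist_dist, ENNReal.toReal_ofReal dist_nonneg, Real.dist_eq]

/-! ### Ordered spectra -/

theorem abs_sub_add_abs_sub_le_of_le {a a' b b' : ℝ} (ha : a ≤ a') (hb : b ≤ b') :
    |a - b| + |a' - b'| ≤ |a - b'| + |a' - b| := by
  rcases abs_cases (a - b) with h | h <;> rcases abs_cases (a' - b') with h' | h' <;>
  rcases abs_cases (a - b') with h'' | h'' <;> rcases abs_cases (a' - b) with h''' | h''' <;>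
  linarith

/-- Ordering both families minimises the `ℓ¹` distance. -/
theorem sum_abs_sub_sort_le {m : ℕ} {a : Fin m → ℝ} (ha : Monotone a) (b : Fin m → ℝ) :
    ∑ i, |a i - (b ∘ Tuple.sort b) i| ≤ ∑ i, |a i - b i| := by
  refine Tuple.bubble_sort_induction (P := fun g => ∑ i, |a i - g i| ≤ ∑ i, |a i - b i|) le_rfl ?_
  intro g i j hij hg h
  refine le_trans ?_ h
  have hne : i ≠ j := hij.ne
  have hj : j ∈ Finset.univ.erase i := by simp [hne.symm]
  have key : ∀ F : Fin m → ℝ, ∑ l, F l = F i + (F j + ∑ l ∈ (Finset.univ.erase i).erase j, F l) := by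
    intro F
    rw [← Finset.add_sum_erase _ F (Finset.mem_univ i), ← Finset.add_sum_erase _ F hj]
  rw [key, key fun l => |a l - g l|]
  have hrest : ∑ l ∈ (Finset.univ.erase i).erase j, |a l - (g ∘ Equiv.swap i j) l| =
      ∑ l ∈ (Finset.univ.erase i).erase j, |a l - g l| := by
    refine Finset.sum_congr rfl fun l hl => ?_
    simp only [Finset.mem_erase, Finset.mem_univ, and_true] at hl
    simp [Equiv.swap_apply_of_ne_of_ne hl.2 hl.1]
  rw [hrest]
  simp only [Function.comp_apply, Equiv.swap_apply_left, Equiv.swap_apply_right]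
  have := abs_sub_add_abs_sub_le_of_le (ha hij.le) hg.le
  linarith

theorem sum_abs_sub_le_of_antitone_of_perm {m : ℕ} {a b : Fin m → ℝ} (ha : Antitone a)
    (hb : Antitone b) (e f : Equiv.Perm (Fin m)) :
    ∑ i, |a i - b i| ≤ ∑ i, |a (e i) - b (f i)| := by
  -- Negation turns antitone families into monotone ones.
  have hna : Monotone fun i => -a i := fun i j h => neg_le_neg (ha h)
  have hnb : Monotone fun i => -b i := fun i j h => neg_le_neg (hb h)
  let g : Fin m → ℝ := fun i => -b (f (e.symm i))
  have hsort : g ∘ Tuple.sort g = fun i => -b i := by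
    have h1 : g = (fun i => -b i) ∘ (e.symm.trans f) := rfl
    have h2 : g ∘ Tuple.sort g = (fun i => -b i) ∘ ((Tuple.sort g).trans (e.symm.trans f)) := rfl
    rw [h2]
    have h3 := Tuple.unique_monotone (f := fun i => -b i)
      (σ := (Tuple.sort g).trans (e.symm.trans f)) (τ := 1) (Tuple.monotone_sort g) (by simpa using hnb)
    simpa using h3
  have h := sum_abs_sub_sort_le hna g
  rw [hsort] at h
  have e1 : ∀ x y : ℝ, |-x - -y| = |x - y| := fun x y => by
    rw [← abs_neg]; congr 1; ring
  simp only [g, e1] at h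
  refine h.trans (le_of_eq ?_)
  rw [← Equiv.sum_comp e]
  simp

/-- Two finite families with the same multiset of values are reindexings of each other. -/
theorem exists_equiv_of_map_univ_eq {ι κ γ : Type*} [Fintype ι] [Fintype κ] {f : ι → γ} {g : κ → γ}
    (h : (Finset.univ.val.map fun i => f i) = Finset.univ.val.map fun j => g j) :
    ∃ e : ι ≃ κ, ∀ i, f i = g (e i) := by
  classical
  have hc : ∀ c, Nonempty ({a // f a = c} ≃ {b // g b = c}) := by
    intro c
    have h1 := congrArg (Multiset.count c) h
    simp only [Multiset.count_map, eq_comm (a := c)] at h1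
    refine ⟨Fintype.equivOfCardEq ?_⟩
    rw [Fintype.card_subtype, Fintype.card_subtype]
    exact h1
  let e := fun c => Classical.choice (hc c)
  exact ⟨Equiv.ofFiberEquiv e, fun i => (Equiv.ofFiberEquiv_map e i).symm⟩

section Spectrum

variable {n : Type*} [Fintype n] [DecidableEq n]

theorem roots_charpoly_unitary_conj_diagonal {U : Matrix n n ℂ}
    (hU : U ∈ Matrix.unitaryGroup n ℂ) (p : n → ℝ) :
    (U * Matrix.diagonal (fun i => (p i : ℂ)) * Uᴴ).charpoly.roots =
      Finset.univ.val.map fun i => (p i : ℂ) := by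
  have h1 : Uᴴ * U = 1 := Matrix.mem_unitaryGroup_iff'.1 hU
  rw [Matrix.charpoly_mul_comm, ← mul_assoc, h1, one_mul, Matrix.charpoly_diagonal,
    Polynomial.roots_prod]
  · simp
  · simp [Finset.prod_ne_zero_iff, Polynomial.X_sub_C_ne_zero]

/-- The eigenvalue lists of two eigendecompositions of one matrix have equal symmetric sums. -/
theorem sum_eq_of_unitary_conj_diagonal_eq {U V : Matrix n n ℂ}
    (hU : U ∈ Matrix.unitaryGroup n ℂ) (hV : V ∈ Matrix.unitaryGroup n ℂ) {p q : n → ℝ}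
    (h : U * Matrix.diagonal (fun i => (p i : ℂ)) * Uᴴ =
      V * Matrix.diagonal (fun i => (q i : ℂ)) * Vᴴ) (φ : ℝ → ℝ) :
    ∑ i, φ (p i) = ∑ i, φ (q i) := by
  have hr := congrArg (fun A => (A.charpoly.roots.map Complex.re).map φ) h
  simp only [roots_charpoly_unitary_conj_diagonal hU, roots_charpoly_unitary_conj_diagonal hV,
    Multiset.map_map, Function.comp_def, Complex.ofReal_re] at hr
  exact congrArg Multiset.sum hr

theorem isHermitian_unitary_conj_diagonal (U : Matrix n n ℂ) (p : n → ℝ) :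
    (U * Matrix.diagonal (fun i => (p i : ℂ)) * Uᴴ).IsHermitian := by
  refine Matrix.isHermitian_mul_mul_conjTranspose U ?_
  rw [Matrix.isHermitian_diagonal_iff]
  intro i
  simp [IsSelfAdjoint]

theorem exists_sortedEigenvalues_eq {U : Matrix n n ℂ}
    (hU : U ∈ Matrix.unitaryGroup n ℂ) (p : n → ℝ) :
    Antitone (sortedEigenvalues (U * Matrix.diagonal (fun i => (p i : ℂ)) * Uᴴ)) ∧
    ∃ e : n ≃ Fin (Fintype.card n), ∀ i,
      p i = sortedEigenvalues (U * Matrix.diagonal (fun i => (p i : ℂ)) * Uᴴ) (e i) := by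
  have hA := isHermitian_unitary_conj_diagonal U p
  have hs : sortedEigenvalues (U * Matrix.diagonal (fun i => (p i : ℂ)) * Uᴴ) =
      hA.eigenvalues₀ := by simp [sortedEigenvalues, hA]
  rw [hs]
  refine ⟨hA.eigenvalues₀_antitone, ?_⟩
  have h1 := hA.roots_charpoly_eq_eigenvalues₀
  rw [roots_charpoly_unitary_conj_diagonal hU] at h1
  have h2 := congrArg (Multiset.map Complex.re) h1
  simp only [Multiset.map_map, Function.comp_def, Complex.ofReal_re, RCLike.ofReal_eq_complex_ofReal] at h2
  exact exists_equiv_of_map_univ_eq h2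

/-- The Wasserstein distance is at most the `ℓ¹` distance for any enumeration of the spectra. -/
theorem wasserstein_le {U V : Matrix n n ℂ}
    (hU : U ∈ Matrix.unitaryGroup n ℂ) (hV : V ∈ Matrix.unitaryGroup n ℂ) (p q : n → ℝ) :
    wasserstein (U * Matrix.diagonal (fun i => (p i : ℂ)) * Uᴴ)
      (V * Matrix.diagonal (fun i => (q i : ℂ)) * Vᴴ) ≤ (1 / 2) * ∑ i, |p i - q i| := by
  obtain ⟨ha, e, he⟩ := exists_sortedEigenvalues_eq hU p
  obtain ⟨hb, f, hf⟩ := exists_sortedEigenvalues_eq hV q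
  rw [wasserstein]
  refine mul_le_mul_of_nonneg_left ?_ (by norm_num)
  let c := Fintype.equivFin n
  refine (sum_abs_sub_le_of_antitone_of_perm ha hb (c.symm.trans e) (c.symm.trans f)).trans
    (le_of_eq ?_)
  rw [← Equiv.sum_comp c]
  simp only [Equiv.trans_apply, Equiv.symm_apply_apply, ← he, ← hf]

end Spectrum

/-! ### Entropy production of a jump process -/

theorem two_mul_sub_one_sq_le_mul_log {y : ℝ} (hy : 0 < y) :
    2 * (y - 1) ^ 2 ≤ (y + 1) * ((y - 1) * Real.log y) := by
  have key : ∀ z : ℝ, 1 ≤ z → 2 * (z - 1) ^ 2 ≤ (z + 1) * ((z - 1) * Real.log z) := by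
    intro z hz
    have h := Real.le_log_one_add_of_nonneg (sub_nonneg.2 hz)
    rw [add_sub_cancel, div_le_iff₀ (by linarith)] at h
    nlinarith [mul_le_mul_of_nonneg_left h (sub_nonneg.2 hz)]
  rcases le_total 1 y with h | h
  · exact key y h
  · have h1 := key y⁻¹ ((one_le_inv₀ hy).2 h)
    rw [Real.log_inv] at h1
    have h2 := mul_le_mul_of_nonneg_left h1 (sq_nonneg y)
    have e1 : y ^ 2 * (2 * (y⁻¹ - 1) ^ 2) = 2 * (y - 1) ^ 2 := by field_simp; ring
    have e2 : y ^ 2 * ((y⁻¹ + 1) * ((y⁻¹ - 1) * -Real.log y)) =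
        (y + 1) * ((y - 1) * Real.log y) := by field_simp; ring
    rwa [e1, e2] at h2

/-- The affinity `X` of a pair of opposite fluxes `b e^X` and `b` times their difference controls
the square of the difference, in the form linearised at `x`. -/
theorem flux_affinity_inequality {b : ℝ} (hb : 0 ≤ b) (X x : ℝ) :
    x * |b * Real.exp X - b| - x ^ 2 / 4 * (b * Real.exp X + b) ≤
      (b * Real.exp X - b) * X / 2 := by
  have hy := Real.exp_pos X
  have h := two_mul_sub_one_sq_le_mul_log hy
  rw [Real.log_exp] at h
  set y := Real.exp X
  have e : b * y - b = b * (y - 1) := by ring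
  rw [e, abs_mul, abs_of_nonneg hb]
  have hd : |y - 1| ^ 2 = (y - 1) ^ 2 := sq_abs _
  set d := |y - 1|
  have hq : 0 ≤ (y - 1) * X / 2 - x * d + x ^ 2 / 4 * (y + 1) := by
    have h4 : 0 ≤ (y + 1) * ((y - 1) * X / 2 - x * d + x ^ 2 / 4 * (y + 1)) := by
      nlinarith [sq_nonneg ((y + 1) * x / 2 - d)]
    exact nonneg_of_mul_nonneg_right h4 (by linarith)
  nlinarith [mul_nonneg hb hq]

/-- Trade-off between speed, dynamical activity and entropy production of a jump process with
occupation probabilities `p`, transition rates `r k i j` from `j` to `i`, and local detailed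
balance. With `x` free, this is the linearised form of
`(½ ∑ |ṗ|)² ≤ ½ (activity) (entropy production)`. -/
theorem jump_process_speed_limit {n K : Type*} [Fintype n] [Fintype K] {pair : K → K}
    (hpair : Function.Involutive pair) {p : n → ℝ} (hp : ∀ i, 0 < p i) {r : K → n → n → ℝ}
    (hr : ∀ k i j, 0 ≤ r k i j) {θ : K → ℝ} (hθ : ∀ k, θ (pair k) = -θ k)
    (hdb : ∀ k i j, r k i j = Real.exp (θ k) * r (pair k) j i) {v : n → ℝ}
    (hv : ∀ i, v i = ∑ k, ∑ j, (r k i j * p j - r k j i * p i)) {x : ℝ} (hx : 0 ≤ x) :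
    x * ∑ i, |v i| - x ^ 2 / 2 * ∑ k, ∑ i, ∑ j, r k i j * p j ≤
      -(∑ i, v i * Real.log (p i)) + ∑ k, θ k * ∑ i, ∑ j, r k i j * p j := by
  let σ : Equiv.Perm K := hpair.toPerm
  have hσ : ∀ k, σ k = pair k := fun _ => rfl
  let a : K → n → n → ℝ := fun k i j => r k i j * p j
  let X : K → n → n → ℝ := fun k i j => Real.log (p j) - Real.log (p i) + θ k
  have hX : ∀ k i j, X (pair k) j i = -X k i j := by
    intro k i j
    simp only [X, hθ]
    ring
  have haX : ∀ k i j, a k i j = a (pair k) j i * Real.exp (X k i j) := by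
    intro k i j
    simp only [a, X, Real.exp_add, Real.exp_sub, Real.exp_log (hp _), hdb k i j]
    field_simp [(hp i).ne']
  have hswap : ∀ F : K → n → n → ℝ,
      ∑ k, ∑ i, ∑ j, F (pair k) j i = ∑ k, ∑ i, ∑ j, F k i j := by
    intro F
    rw [← Equiv.sum_comp σ fun k => ∑ i, ∑ j, F k i j]
    exact Finset.sum_congr rfl fun k _ => Finset.sum_comm
  have hv' : ∀ i, v i = ∑ k, ∑ j, (a k i j - a (pair k) j i) := by
    intro i
    rw [hv]
    simp only [Finset.sum_sub_distrib]
    congr 1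
    exact (Equiv.sum_comp σ fun k => ∑ j, r k j i * p i).symm
  have hspeed : ∑ i, |v i| ≤ ∑ k, ∑ i, ∑ j, |a k i j - a (pair k) j i| := by
    rw [Finset.sum_comm]
    refine Finset.sum_le_sum fun i _ => ?_
    rw [hv']
    refine (Finset.abs_sum_le_sum_abs _ _).trans ?_
    exact Finset.sum_le_sum fun k _ => Finset.abs_sum_le_sum_abs _ _
  have hact : 2 * ∑ k, ∑ i, ∑ j, a k i j = ∑ k, ∑ i, ∑ j, (a k i j + a (pair k) j i) := by
    simp only [Finset.sum_add_distrib, hswap a]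
    ring
  have hent : -(∑ i, v i * Real.log (p i)) + ∑ k, θ k * ∑ i, ∑ j, r k i j * p j =
      ∑ k, ∑ i, ∑ j, a k i j * X k i j := by
    have h1 : ∑ i, v i * Real.log (p i) =
        ∑ k, ∑ i, ∑ j, a k i j * (Real.log (p i) - Real.log (p j)) := by
      have h2 : ∑ k, ∑ i, ∑ j, a k i j * Real.log (p j) =
          ∑ k, ∑ i, ∑ j, a k j i * Real.log (p i) :=
        Finset.sum_congr rfl fun k _ => Finset.sum_comm
      simp only [mul_sub, Finset.sum_sub_distrib]
      rw [h2]
      simp only [← Finset.sum_sub_distrib]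
      rw [Finset.sum_comm]
      refine Finset.sum_congr rfl fun i _ => ?_
      rw [hv, Finset.sum_mul]
      refine Finset.sum_congr rfl fun k _ => ?_
      rw [Finset.sum_mul]
      exact Finset.sum_congr rfl fun j _ => by simp only [a]; ring
    rw [h1]
    simp only [Finset.mul_sum, ← Finset.sum_neg_distrib, ← Finset.sum_add_distrib]
    refine Finset.sum_congr rfl fun k _ => Finset.sum_congr rfl fun i _ =>
      Finset.sum_congr rfl fun j _ => ?_
    simp only [a, X]
    ring
  have hent2 : ∑ k, ∑ i, ∑ j, a k i j * X k i j =
      ∑ k, ∑ i, ∑ j, (a k i j - a (pair k) j i) * X k i j / 2 := by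
    have h3 := hswap fun k i j => a k i j * X k i j
    simp only [hX] at h3
    have h4 : ∑ k, ∑ i, ∑ j, (a k i j - a (pair k) j i) * X k i j / 2 =
        (∑ k, ∑ i, ∑ j, a k i j * X k i j + ∑ k, ∑ i, ∑ j, a (pair k) j i * -X k i j) / 2 := by
      simp only [← Finset.sum_add_distrib, Finset.sum_div]
      refine Finset.sum_congr rfl fun k _ => Finset.sum_congr rfl fun i _ =>
        Finset.sum_congr rfl fun j _ => ?_
      ring
    rw [h4, h3]
    ring
  rw [hent, hent2]
  have hpos : ∀ k i j, 0 ≤ a k i j := fun k i j => mul_nonneg (hr k i j) (hp j).le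
  have hpt : ∀ k i j, x * |a k i j - a (pair k) j i| -
      x ^ 2 / 4 * (a k i j + a (pair k) j i) ≤ (a k i j - a (pair k) j i) * X k i j / 2 := by
    intro k i j
    have h := flux_affinity_inequality (hpos (pair k) j i) (X k i j) x
    rwa [← haX] at h
  have hsum : ∑ k, ∑ i, ∑ j, (x * |a k i j - a (pair k) j i| -
      x ^ 2 / 4 * (a k i j + a (pair k) j i)) ≤
      ∑ k, ∑ i, ∑ j, (a k i j - a (pair k) j i) * X k i j / 2 :=
    Finset.sum_le_sum fun k _ => Finset.sum_le_sum fun i _ => Finset.sum_le_sum fun j _ => hpt k i j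
  refine le_trans ?_ hsum
  simp only [Finset.sum_sub_distrib, ← Finset.mul_sum]
  rw [← hact]
  have := mul_le_mul_of_nonneg_left hspeed hx
  simp only [a] at this ⊢
  linarith

/-! ### The Lindblad equation in an eigenbasis of the state -/

section Lindblad

variable {n K : Type*} [Fintype n] [Fintype K]

theorem lindbladian_unitary_conj [DecidableEq n] {U : Matrix n n ℂ}
    (hU : U ∈ Matrix.unitaryGroup n ℂ) (H : Matrix n n ℂ) (L : K → Matrix n n ℂ)
    (D : Matrix n n ℂ) :
    Uᴴ * lindbladian H L (U * D * Uᴴ) * U =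
      lindbladian (Uᴴ * H * U) (fun k => Uᴴ * L k * U) D := by
  have h1 : Uᴴ * U = 1 := Matrix.mem_unitaryGroup_iff'.1 hU
  have h2 : U * Uᴴ = 1 := Matrix.mem_unitaryGroup_iff.1 hU
  have h1' : ∀ X : Matrix n n ℂ, Uᴴ * (U * X) = X := fun X => by rw [← mul_assoc, h1, one_mul]
  have h2' : ∀ X : Matrix n n ℂ, U * (Uᴴ * X) = X := fun X => by rw [← mul_assoc, h2, one_mul]
  simp only [lindbladian, dissipator, Matrix.mul_add, Matrix.add_mul, Matrix.mul_sub,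
    Matrix.sub_mul, Matrix.mul_smul, Matrix.smul_mul, Matrix.mul_sum, Matrix.sum_mul,
    Matrix.conjTranspose_mul, Matrix.conjTranspose_conjTranspose, Matrix.mul_assoc, h1', h2', h1,
    mul_one]

theorem mul_diagonal_mul_conjTranspose_apply_re [DecidableEq n] (M : Matrix n n ℂ) (p : n → ℝ)
    (i : n) : ((M * Matrix.diagonal (fun i => (p i : ℂ)) * Mᴴ) i i).re =
      ∑ j, Complex.normSq (M i j) * p j := by
  rw [Matrix.mul_apply, Complex.re_sum]
  refine Finset.sum_congr rfl fun j _ => ?_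
  rw [Matrix.mul_diagonal]
  simp [Complex.normSq_apply]
  ring

theorem trace_unitary_conj_activity [DecidableEq n] {U : Matrix n n ℂ}
    (hU : U ∈ Matrix.unitaryGroup n ℂ) (L : Matrix n n ℂ) (p : n → ℝ) :
    ((L * (U * Matrix.diagonal (fun i => (p i : ℂ)) * Uᴴ) * Lᴴ).trace).re =
      ∑ i, ∑ j, Complex.normSq ((Uᴴ * L * U) i j) * p j := by
  have h2 : U * Uᴴ = 1 := Matrix.mem_unitaryGroup_iff.1 hU
  have h3 : (L * (U * Matrix.diagonal (fun i => (p i : ℂ)) * Uᴴ) * Lᴴ).trace =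
      ((Uᴴ * L * U) * Matrix.diagonal (fun i => (p i : ℂ)) * (Uᴴ * L * U)ᴴ).trace := by
    have : (Uᴴ * L * U) * Matrix.diagonal (fun i => (p i : ℂ)) * (Uᴴ * L * U)ᴴ =
        Uᴴ * (L * (U * Matrix.diagonal (fun i => (p i : ℂ)) * Uᴴ) * Lᴴ * U) := by
      simp only [Matrix.conjTranspose_mul, Matrix.conjTranspose_conjTranspose, Matrix.mul_assoc]
    rw [this, Matrix.trace_mul_comm Uᴴ, mul_assoc _ U, h2, mul_one]
  rw [h3]
  generalize Uᴴ * L * U = M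
  rw [Matrix.trace, Complex.re_sum]
  exact Finset.sum_congr rfl fun i _ => mul_diagonal_mul_conjTranspose_apply_re M p i

theorem lindbladian_diagonal_apply_re [DecidableEq n] (H : Matrix n n ℂ) (L : K → Matrix n n ℂ)
    (p : n → ℝ) (i : n) :
    (lindbladian H L (Matrix.diagonal fun i => (p i : ℂ)) i i).re =
      ∑ k, ∑ j, (Complex.normSq (L k i j) * p j - Complex.normSq (L k j i) * p i) := by
  simp only [lindbladian, dissipator, Matrix.add_apply, Matrix.smul_apply, Matrix.sub_apply,
    Matrix.sum_apply, Matrix.mul_diagonal, Matrix.diagonal_mul, Complex.add_re, Complex.re_sum]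
  have h0 : (-Complex.I • (H i i * (p i : ℂ) - (p i : ℂ) * H i i)).re = 0 := by
    rw [mul_comm, sub_self, smul_zero, Complex.zero_re]
  rw [h0, zero_add]
  refine Finset.sum_congr rfl fun k _ => ?_
  have e : ((1 / 2 : ℂ) • (((L k)ᴴ * L k) i i * (p i : ℂ) +
      (p i : ℂ) * ((L k)ᴴ * L k) i i)).re = ∑ j, Complex.normSq (L k j i) * p i := by
    have e1 : (1 / 2 : ℂ) • (((L k)ᴴ * L k) i i * (p i : ℂ) + (p i : ℂ) * ((L k)ᴴ * L k) i i) =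
        ((L k)ᴴ * L k) i i * (p i : ℂ) := by
      rw [smul_eq_mul]
      ring
    rw [e1, Matrix.mul_apply, Finset.sum_mul, Complex.re_sum]
    refine Finset.sum_congr rfl fun j _ => ?_
    simp [Complex.normSq_apply]
  rw [Complex.sub_re, e, mul_diagonal_mul_conjTranspose_apply_re, ← Finset.sum_sub_distrib]

/-- The occupation probabilities of the eigenstates follow a jump process. -/
theorem lindbladian_populations [DecidableEq n] {U : Matrix n n ℂ}
    (hU : U ∈ Matrix.unitaryGroup n ℂ) (H : Matrix n n ℂ) (L : K → Matrix n n ℂ)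
    (p : n → ℝ) (i : n) :
    ((Uᴴ * lindbladian H L (U * Matrix.diagonal (fun i => (p i : ℂ)) * Uᴴ) * U) i i).re =
      ∑ k, ∑ j, (Complex.normSq ((Uᴴ * L k * U) i j) * p j -
        Complex.normSq ((Uᴴ * L k * U) j i) * p i) := by
  rw [lindbladian_unitary_conj hU, lindbladian_diagonal_apply_re]

/-- The heat current is carried by the jumps, each of which releases the energy `ω k`. -/
theorem trace_mul_lindbladian {H : Matrix n n ℂ} (hH : H.IsHermitian) {L : K → Matrix n n ℂ}
    {ω : K → ℝ} (hω : ∀ k, L k * H - H * L k = ω k • L k) (ρ : Matrix n n ℂ) :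
    ((H * lindbladian H L ρ).trace).re = -∑ k, ω k * ((L k * ρ * (L k)ᴴ).trace).re := by
  have h0 : (H * ((-Complex.I) • (H * ρ - ρ * H))).trace = 0 := by
    rw [Matrix.mul_smul, Matrix.trace_smul, Matrix.mul_sub, Matrix.trace_sub,
      ← mul_assoc H ρ H, Matrix.trace_mul_comm (H * ρ) H, sub_self, smul_zero]
  rw [lindbladian, Matrix.mul_add, Matrix.trace_add, h0, zero_add, Matrix.mul_sum,
    Matrix.trace_sum, Complex.re_sum, ← Finset.sum_neg_distrib]
  refine Finset.sum_congr rfl fun k _ => ?_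
  have h1 : H * L k = L k * H - ω k • L k := by rw [← hω k]; abel
  have h2 : H * (L k)ᴴ = (L k)ᴴ * H + ω k • (L k)ᴴ := by
    have h := congrArg Matrix.conjTranspose (hω k)
    simp only [Matrix.conjTranspose_sub, Matrix.conjTranspose_mul, hH.eq,
      Matrix.conjTranspose_smul, star_trivial] at h
    rw [← h]; abel
  have h3 : H * ((L k)ᴴ * L k) = (L k)ᴴ * L k * H := by
    rw [← mul_assoc, h2, Matrix.add_mul, mul_assoc, h1, Matrix.mul_sub, Matrix.smul_mul,
      Matrix.mul_smul, mul_assoc]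
    abel
  have h4 : (H * (L k * ρ * (L k)ᴴ)).trace =
      ((L k)ᴴ * L k * H * ρ).trace - ω k • ((L k)ᴴ * L k * ρ).trace := by
    rw [← mul_assoc, ← mul_assoc, Matrix.trace_mul_comm, ← mul_assoc, h1, Matrix.mul_sub,
      Matrix.sub_mul, Matrix.trace_sub, Matrix.mul_smul, Matrix.smul_mul, Matrix.trace_smul,
      ← mul_assoc]
  have h5 : (H * (ρ * ((L k)ᴴ * L k))).trace = ((L k)ᴴ * L k * H * ρ).trace := by
    rw [← mul_assoc, Matrix.trace_mul_comm, ← mul_assoc]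
  have h6 : (H * ((L k)ᴴ * L k * ρ)).trace = ((L k)ᴴ * L k * H * ρ).trace := by
    rw [← mul_assoc, h3]
  have h7 : (L k * ρ * (L k)ᴴ).trace = ((L k)ᴴ * L k * ρ).trace := by
    rw [Matrix.trace_mul_comm, ← mul_assoc]
  rw [dissipator, Matrix.mul_sub, Matrix.mul_smul, Matrix.mul_add, Matrix.trace_sub,
    Matrix.trace_smul, Matrix.trace_add, h4, h5, h6, h7]
  simp
  ring

/-- A state that commutes with the Hamiltonian, and through which jumps pass with Boltzmann
factors, is stationary under local detailed balance: gain from the jump `k` cancels loss through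
its partner. -/
theorem lindbladian_eq_zero_of_detailed_balance {pair : K → K}
    (hpair : Function.Involutive pair) {H π : Matrix n n ℂ} {L : K → Matrix n n ℂ} {θ : K → ℝ}
    (hθ : ∀ k, θ (pair k) = -θ k) (hH : H * π = π * H)
    (hπ : ∀ k, π * L k = Real.exp (θ k) • (L k * π))
    (hdb : ∀ k, L k = Real.exp (θ k / 2) • (L (pair k))ᴴ) :
    lindbladian H L π = 0 := by
  have hstar : ∀ k, (L k)ᴴ = Real.exp (θ k / 2) • L (pair k) := by
    intro k
    conv_lhs => rw [hdb k]
    simp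
  have hπ' : ∀ k, π * (L k)ᴴ = Real.exp (-θ k) • ((L k)ᴴ * π) := by
    intro k
    rw [hstar, Matrix.mul_smul, hπ, hθ, Matrix.smul_mul, smul_comm]
  have hgain : ∀ k, L k * π * (L k)ᴴ = π * ((L (pair k))ᴴ * L (pair k)) := by
    intro k
    have h1 : L k * π = Real.exp (-θ k) • (π * L k) := by
      rw [hπ, smul_smul, ← Real.exp_add]; simp
    have h2 : L k * (L k)ᴴ = Real.exp (θ k) • ((L (pair k))ᴴ * L (pair k)) := by
      rw [hstar k]
      conv_lhs => rw [hdb k]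
      rw [Matrix.smul_mul, Matrix.mul_smul, smul_smul, ← Real.exp_add, add_halves]
    rw [h1, Matrix.smul_mul, mul_assoc, h2, Matrix.mul_smul, smul_smul, ← Real.exp_add]
    simp
  have hcomm : ∀ k, (L k)ᴴ * L k * π = π * ((L k)ᴴ * L k) := by
    intro k
    rw [← mul_assoc π, hπ', Matrix.smul_mul, mul_assoc _ π, hπ, Matrix.mul_smul, smul_smul,
      ← Real.exp_add]
    simp [mul_assoc]
  rw [lindbladian, hH, sub_self, smul_zero, zero_add]
  have hd : ∀ k, dissipator (L k) π =
      π * ((L (pair k))ᴴ * L (pair k)) - π * ((L k)ᴴ * L k) := by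
    intro k
    rw [dissipator, hgain, hcomm, ← two_smul ℂ, smul_smul]
    norm_num
  simp only [hd, Finset.sum_sub_distrib]
  exact sub_eq_zero.2 (Equiv.sum_comp hpair.toPerm fun k => π * ((L k)ᴴ * L k))

/-- Speed limit for a full-rank state of the Lindblad equation, linearised at `x`: the rate of change
of the spectrum is bounded by the dynamical activity and the entropy production
`Ṡ - β tr(H ρ̇)`. -/
theorem lindbladian_speed_limit [DecidableEq n] {pair : K → K}
    (hpair : Function.Involutive pair) {H : Matrix n n ℂ} (hH : H.IsHermitian)
    {L : K → Matrix n n ℂ} {ω : K → ℝ} (hωp : ∀ k, ω (pair k) = -ω k)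
    (hω : ∀ k, L k * H - H * L k = ω k • L k) {β : ℝ}
    (hdb : ∀ k, L k = Real.exp (β * ω k / 2) • (L (pair k))ᴴ) {U : Matrix n n ℂ}
    (hU : U ∈ Matrix.unitaryGroup n ℂ) {p : n → ℝ} (hp : ∀ i, 0 < p i) {ρ : Matrix n n ℂ}
    (hρ : ρ = U * Matrix.diagonal (fun i => (p i : ℂ)) * Uᴴ) {x : ℝ} (hx : 0 ≤ x) :
    x * ∑ i, |((Uᴴ * lindbladian H L ρ * U) i i).re| -
        x ^ 2 / 2 * ∑ k, ((L k * ρ * (L k)ᴴ).trace).re ≤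
      -(∑ i, ((Uᴴ * lindbladian H L ρ * U) i i).re * Real.log (p i)) -
        β * ((H * lindbladian H L ρ).trace).re := by
  have hrate : ∀ k i j, Complex.normSq ((Uᴴ * L k * U) i j) =
      Real.exp (β * ω k) * Complex.normSq ((Uᴴ * L (pair k) * U) j i) := by
    intro k i j
    have h1 : Uᴴ * L k * U = Real.exp (β * ω k / 2) • (Uᴴ * L (pair k) * U)ᴴ := by
      conv_lhs => rw [hdb k]
      simp [Matrix.mul_assoc]
    rw [h1, Matrix.smul_apply, Matrix.conjTranspose_apply, Complex.real_smul, Complex.normSq_mul,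
      Complex.normSq_ofReal, ← Real.exp_add, add_halves]
    congr 1
    exact Complex.normSq_conj _
  have h := jump_process_speed_limit hpair hp
    (r := fun k i j => Complex.normSq ((Uᴴ * L k * U) i j))
    (fun k i j => Complex.normSq_nonneg _) (θ := fun k => β * ω k)
    (fun k => by rw [hωp]; ring) hrate
    (v := fun i => ((Uᴴ * lindbladian H L ρ * U) i i).re)
    (fun i => by rw [hρ]; exact lindbladian_populations hU H L p i) hx
  rw [trace_mul_lindbladian hH hω ρ]
  simp only [hρ, trace_unitary_conj_activity hU] at h ⊢
  refine h.trans (le_of_eq ?_)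
  rw [mul_neg, sub_neg_eq_add, Finset.mul_sum]
  simp only [mul_assoc]

end Lindblad

/-! ### Gibbs states -/

theorem isHermitian_neg_smul {n : Type*} {H : Matrix n n ℂ} (hH : H.IsHermitian) (β : ℝ) :
    (-(β • H)).IsHermitian := by
  rw [Matrix.IsHermitian, Matrix.conjTranspose_neg, Matrix.conjTranspose_smul, hH.eq,
    star_trivial]

section Gibbs

variable {n : Type*} [Fintype n] [DecidableEq n]

theorem posDef_exp_of_isHermitian {A : Matrix n n ℂ} (hA : A.IsHermitian) :
    (NormedSpace.exp A).PosDef := by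
  let B := NormedSpace.exp ((2 : ℝ)⁻¹ • A)
  have hB : Bᴴ = B := by
    refine Matrix.IsHermitian.exp ?_
    rw [Matrix.IsHermitian, Matrix.conjTranspose_smul, hA.eq, star_trivial]
  have hBB : NormedSpace.exp A = Bᴴ * B := by
    rw [hB, ← Matrix.exp_add_of_commute _ _ (Commute.refl _), ← add_smul]
    norm_num
  rw [hBB]
  exact Matrix.PosDef.conjTranspose_mul_self B
    (Matrix.mulVec_injective_of_isUnit (Matrix.isUnit_exp _))

theorem gibbs_posDef [Nonempty n] {H : Matrix n n ℂ} (hH : H.IsHermitian) (T : ℝ) :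
    (gibbs H T).PosDef := by
  have h := posDef_exp_of_isHermitian (isHermitian_neg_smul hH T⁻¹)
  exact h.smul (inv_pos.2 h.trace_pos)

theorem commute_gibbs (H : Matrix n n ℂ) (T : ℝ) : H * gibbs H T = gibbs H T * H := by
  have h : Commute H (NormedSpace.exp (-(T⁻¹ • H))) :=
    (((Commute.refl H).smul_right T⁻¹).neg_right).exp_right
  rw [gibbs, Matrix.mul_smul, Matrix.smul_mul, h.eq]

/-- A jump that releases the energy `ω` passes through the Gibbs state with a Boltzmann factor. -/
theorem gibbs_mul_jump {H L : Matrix n n ℂ} {ω : ℝ} (hω : L * H - H * L = ω • L) (T : ℝ) :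
    gibbs H T * L = Real.exp (T⁻¹ * ω) • (L * gibbs H T) := by
  have hs : SemiconjBy L (-(T⁻¹ • H)) (-(T⁻¹ • H) + algebraMap ℝ (Matrix n n ℂ) (-(T⁻¹ * ω))) := by
    have h1 : L * H = H * L + ω • L := by rw [← hω]; abel
    rw [SemiconjBy, Matrix.add_mul, ← Algebra.smul_def, Matrix.mul_neg, Matrix.mul_smul, h1,
      Matrix.neg_mul, Matrix.smul_mul, smul_add, smul_smul, neg_smul]
    abel
  have hsc : NormedSpace.exp (algebraMap ℝ (Matrix n n ℂ) (-(T⁻¹ * ω))) =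
      algebraMap ℝ (Matrix n n ℂ) (Real.exp (-(T⁻¹ * ω))) := by
    rw [Real.exp_eq_exp_ℝ]
    exact (NormedSpace.algebraMap_exp_comm (-(T⁻¹ * ω))).symm
  have h2 : L * NormedSpace.exp (-(T⁻¹ • H)) = NormedSpace.exp (-(T⁻¹ • H) +
      algebraMap ℝ (Matrix n n ℂ) (-(T⁻¹ * ω))) * L := hs.exp_right.eq
  rw [Matrix.exp_add_of_commute _ _ (Algebra.commutes (-(T⁻¹ * ω)) (-(T⁻¹ • H))).symm,
    hsc, ← Algebra.commutes, mul_assoc, ← Algebra.smul_def] at h2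
  have h3 : NormedSpace.exp (-(T⁻¹ • H)) * L =
      Real.exp (T⁻¹ * ω) • (L * NormedSpace.exp (-(T⁻¹ • H))) := by
    rw [h2, smul_smul, ← Real.exp_add]
    simp
  rw [gibbs, Matrix.mul_smul, Matrix.smul_mul, h3, smul_comm]

end Gibbs

/-! ### Perturbation of eigenvalues -/

section HellmannFeynman

variable {n : Type*} [Fintype n] [DecidableEq n]

/-- Hellmann–Feynman: with continuous eigenvectors, the eigenvalues are differentiable wherever the
matrix is, also at crossings. -/
theorem IsEigenDecomposition.hasDerivAt {A : ℝ → Matrix n n ℂ} {p : ℝ → n → ℝ}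
    {U : ℝ → Matrix n n ℂ} (hdec : IsEigenDecomposition A p U)
    (hU : ContinuousOn U (Set.Icc 0 1)) {s : ℝ} (hs : s ∈ Set.Ioo (0 : ℝ) 1) {A' : Matrix n n ℂ}
    (hA : HasDerivAt A A' s) (i : n) :
    HasDerivAt (fun t => p t i) (((U s)ᴴ * A' * U s) i i).re s := by
  have hs' := Set.Ioo_subset_Icc_self hs
  have hUs : Tendsto U (𝓝[≠] s) (𝓝 (U s)) :=
    (hU.continuousAt (Icc_mem_nhds hs.1 hs.2)).tendsto.mono_left nhdsWithin_le_nhds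
  have hUs' : Tendsto (fun t => (U t)ᴴ) (𝓝[≠] s) (𝓝 (U s)ᴴ) :=
    (continuous_id.matrix_conjTranspose.tendsto (U s)).comp hUs
  have hentry : Continuous fun M : Matrix n n ℂ => M i i := continuous_id.matrix_elem i i
  have hA : Tendsto (slope A s) (𝓝[≠] s) (𝓝 A') := hasDerivAt_iff_tendsto_slope.1 hA
  rw [hasDerivAt_iff_tendsto_slope]
  -- The overlap of the eigenvectors at `t` and at `s`.
  have hc : Tendsto (fun t => ((U t)ᴴ * U s) i i) (𝓝[≠] s) (𝓝 1) := by
    have h1 : Tendsto (fun t => (U t)ᴴ * U s) (𝓝[≠] s) (𝓝 ((U s)ᴴ * U s)) :=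
      hUs'.mul tendsto_const_nhds
    rw [show (U s)ᴴ * U s = 1 from Matrix.mem_unitaryGroup_iff'.1 (hdec s hs').1] at h1
    have h2 := (hentry.tendsto 1).comp h1
    rwa [Matrix.one_apply_eq] at h2
  have hnum : Tendsto (fun t => ((U t)ᴴ * slope A s t * U s) i i) (𝓝[≠] s)
      (𝓝 (((U s)ᴴ * A' * U s) i i)) :=
    (hentry.tendsto _).comp ((hUs'.mul hA).mul tendsto_const_nhds)
  have hq := hnum.div hc one_ne_zero
  rw [div_one] at hq
  have hre := (Complex.continuous_re.tendsto _).comp hq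
  refine hre.congr' ?_
  have hmem : ∀ᶠ t in 𝓝[≠] s, t ∈ Set.Icc (0 : ℝ) 1 :=
    nhdsWithin_le_nhds (Icc_mem_nhds hs.1 hs.2)
  filter_upwards [hmem, hc.eventually_ne one_ne_zero] with t ht hct
  have h1 : (U t)ᴴ * A t = Matrix.diagonal (fun i => (p t i : ℂ)) * (U t)ᴴ := by
    have h : (U t)ᴴ * U t = 1 := Matrix.mem_unitaryGroup_iff'.1 (hdec t ht).1
    rw [(hdec t ht).2, ← mul_assoc, ← mul_assoc, h, one_mul]
  have h2 : A s * U s = U s * Matrix.diagonal (fun i => (p s i : ℂ)) := by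
    have h : (U s)ᴴ * U s = 1 := Matrix.mem_unitaryGroup_iff'.1 (hdec s hs').1
    rw [(hdec s hs').2, mul_assoc, h, mul_one]
  have h3 : ((U t)ᴴ * slope A s t * U s) i i =
      ((slope (fun t => p t i) s t : ℝ) : ℂ) * ((U t)ᴴ * U s) i i := by
    rw [slope_def_module, slope_def_field, Matrix.mul_smul, Matrix.smul_mul, Matrix.mul_sub, h1,
      Matrix.sub_mul, mul_assoc, mul_assoc _ (A s), h2, ← mul_assoc _ (U s), Matrix.smul_apply,
      Matrix.sub_apply, Matrix.diagonal_mul, Matrix.mul_diagonal, Complex.real_smul]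
    push_cast
    ring
  simp only [Function.comp_apply, Pi.div_apply]
  rw [h3, mul_div_assoc, div_self hct, mul_one, Complex.ofReal_re]

theorem IsEigenDecomposition.eigenvalue_eq {A : ℝ → Matrix n n ℂ} {p : ℝ → n → ℝ}
    {U : ℝ → Matrix n n ℂ} (hdec : IsEigenDecomposition A p U) {s : ℝ}
    (hs : s ∈ Set.Icc (0 : ℝ) 1) (i : n) : p s i = (((U s)ᴴ * A s * U s) i i).re := by
  have h : (U s)ᴴ * U s = 1 := Matrix.mem_unitaryGroup_iff'.1 (hdec s hs).1
  rw [(hdec s hs).2, ← mul_assoc, ← mul_assoc, h, one_mul, mul_assoc, h, mul_one,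
    Matrix.diagonal_apply_eq, Complex.ofReal_re]

theorem IsEigenDecomposition.continuousOn {A : ℝ → Matrix n n ℂ} {p : ℝ → n → ℝ}
    {U : ℝ → Matrix n n ℂ} (hdec : IsEigenDecomposition A p U)
    (hU : ContinuousOn U (Set.Icc 0 1)) (hA : ContinuousOn A (Set.Icc 0 1)) (i : n) :
    ContinuousOn (fun t => p t i) (Set.Icc 0 1) := by
  have h : ContinuousOn (fun t => (((U t)ᴴ * A t * U t) i i).re) (Set.Icc 0 1) :=
    (Complex.continuous_re.comp (continuous_id.matrix_elem i i)).comp_continuousOn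
      (((continuous_id.matrix_conjTranspose.comp_continuousOn hU).mul hA).mul hU)
  exact h.congr fun t ht => hdec.eigenvalue_eq ht i

end HellmannFeynman

/-! ### First-order approximation, uniformly over the cycle -/

/-- `f_τ(s) = g(s) + O(τ⁻¹)` as `τ → ∞`, uniformly in `s ∈ [0, 1]`, where `f_τ` is continuous on
`[0, 1]` for large `τ`. -/
structure UniformApprox {E : Type*} [NormedAddCommGroup E] (f : ℝ → ℝ → E) (g : ℝ → E) : Prop where
  isBigO : (fun z : ℝ × ℝ => f z.1 z.2 - g z.2) =O[atTop ×ˢ 𝓟 (Set.Icc (0 : ℝ) 1)]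
    fun z => z.1⁻¹
  continuousOn_approx : ∀ᶠ τ in atTop, ContinuousOn (f τ) (Set.Icc 0 1)

namespace UniformApprox

section General

variable {E F : Type*} [NormedAddCommGroup E] [NormedAddCommGroup F]
  {f f' : ℝ → ℝ → E} {g g' : ℝ → E}

theorem of_bound {C τ₀ : ℝ}
    (h : ∀ τ, τ₀ ≤ τ → ∀ s ∈ Set.Icc (0 : ℝ) 1, ‖f τ s - g s‖ ≤ C / τ)
    (hf : ∀ᶠ τ in atTop, ContinuousOn (f τ) (Set.Icc 0 1)) : UniformApprox f g := by
  refine ⟨Asymptotics.IsBigO.of_bound C ?_, hf⟩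
  rw [eventually_prod_principal_iff]
  filter_upwards [eventually_ge_atTop τ₀, eventually_gt_atTop 0] with τ hτ hτ0 s hs
  rw [norm_inv, Real.norm_of_nonneg hτ0.le, ← div_eq_mul_inv]
  exact h τ hτ s hs

theorem exists_bound (h : UniformApprox f g) : ∃ C : ℝ, 0 ≤ C ∧
    ∀ᶠ τ in atTop, ∀ s ∈ Set.Icc (0 : ℝ) 1, ‖f τ s - g s‖ ≤ C / τ := by
  obtain ⟨C, hC, hb⟩ := h.isBigO.exists_nonneg
  refine ⟨C, hC, ?_⟩
  have hb' := hb.bound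
  rw [eventually_prod_principal_iff] at hb'
  filter_upwards [hb', eventually_gt_atTop 0] with τ hτ hτ0 s hs
  have := hτ s hs
  rwa [norm_inv, Real.norm_of_nonneg hτ0.le, ← div_eq_mul_inv] at this

theorem tendstoUniformlyOn (h : UniformApprox f g) :
    TendstoUniformlyOn f g atTop (Set.Icc 0 1) := by
  obtain ⟨C, hC, hb⟩ := h.exists_bound
  rw [Metric.tendstoUniformlyOn_iff]
  intro ε hε
  have hlim : Tendsto (fun τ : ℝ => C / τ) atTop (𝓝 0) := tendsto_const_nhds.div_atTop tendsto_id
  filter_upwards [hb, hlim.eventually_lt_const hε] with τ h1 h2 s hs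
  rw [dist_comm, dist_eq_norm]
  exact (h1 s hs).trans_lt h2

theorem continuousOn (h : UniformApprox f g) : ContinuousOn g (Set.Icc 0 1) :=
  h.tendstoUniformlyOn.continuousOn h.continuousOn_approx.frequently

theorem congr (h : UniformApprox f g)
    (hff' : ∀ᶠ τ in atTop, Set.EqOn (f τ) (f' τ) (Set.Icc 0 1))
    (hgg' : Set.EqOn g g' (Set.Icc 0 1)) : UniformApprox f' g' := by
  refine ⟨h.isBigO.congr' ?_ EventuallyEq.rfl, ?_⟩
  · rw [EventuallyEq, eventually_prod_principal_iff]
    filter_upwards [hff'] with τ hτ s hs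
    rw [hτ hs, hgg' hs]
  · filter_upwards [hff', h.continuousOn_approx] with τ hτ hc
    exact hc.congr fun s hs => (hτ hs).symm

theorem isBigO_one_of_continuousOn (hg : ContinuousOn g (Set.Icc 0 1)) :
    (fun z : ℝ × ℝ => g z.2) =O[atTop ×ˢ 𝓟 (Set.Icc (0 : ℝ) 1)] fun _ => (1 : ℝ) := by
  obtain ⟨M, hM⟩ := isCompact_Icc.exists_bound_of_continuousOn hg
  refine Asymptotics.IsBigO.of_bound M ?_
  rw [eventually_prod_principal_iff]
  refine Eventually.of_forall fun τ s hs => ?_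
  simpa using hM s hs

theorem const (hg : ContinuousOn g (Set.Icc 0 1)) : UniformApprox (fun _ => g) g :=
  ⟨by simpa using Asymptotics.isBigO_zero _ _, Eventually.of_forall fun _ => hg⟩

theorem add (h : UniformApprox f g) (h' : UniformApprox f' g') :
    UniformApprox (fun τ s => f τ s + f' τ s) fun s => g s + g' s := by
  refine ⟨(h.isBigO.add h'.isBigO).congr_left fun z => by abel, ?_⟩
  filter_upwards [h.continuousOn_approx, h'.continuousOn_approx] with τ h1 h2 using h1.add h2

theorem sub (h : UniformApprox f g) (h' : UniformApprox f' g') :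
    UniformApprox (fun τ s => f τ s - f' τ s) fun s => g s - g' s := by
  refine ⟨(h.isBigO.sub h'.isBigO).congr_left fun z => by abel, ?_⟩
  filter_upwards [h.continuousOn_approx, h'.continuousOn_approx] with τ h1 h2 using h1.sub h2

theorem sum {ι : Type*} (t : Finset ι) {f : ι → ℝ → ℝ → E} {g : ι → ℝ → E}
    (h : ∀ i ∈ t, UniformApprox (f i) (g i)) :
    UniformApprox (fun τ s => ∑ i ∈ t, f i τ s) fun s => ∑ i ∈ t, g i s := by
  classical
  induction t using Finset.induction_on with
  | empty => simpa using const (g := fun _ => (0 : E)) continuousOn_const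
  | insert i t hi ih =>
    simp only [Finset.sum_insert hi]
    exact (h i (Finset.mem_insert_self i t)).add
      (ih fun j hj => h j (Finset.mem_insert_of_mem hj))

theorem lipschitz_comp (h : UniformApprox f g) {φ : E → F} {c : NNReal} (hφ : LipschitzWith c φ) :
    UniformApprox (fun τ s => φ (f τ s)) fun s => φ (g s) := by
  refine ⟨(Asymptotics.IsBigO.of_bound c (Eventually.of_forall fun z => ?_)).trans h.isBigO, ?_⟩
  · have := hφ.dist_le_mul (f z.1 z.2) (g z.2)
    rwa [dist_eq_norm, dist_eq_norm] at this
  · filter_upwards [h.continuousOn_approx] with τ h1 using hφ.continuous.comp_continuousOn h1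

theorem linear_comp [NormedSpace ℝ E] [NormedSpace ℝ F] [FiniteDimensional ℝ E]
    (h : UniformApprox f g) (φ : E →ₗ[ℝ] F) :
    UniformApprox (fun τ s => φ (f τ s)) fun s => φ (g s) :=
  h.lipschitz_comp (LinearMap.toContinuousLinearMap φ).lipschitz

/-- A bounded correction of order `τ⁻¹` is negligible. -/
theorem inv_smul [NormedSpace ℝ E] (h : UniformApprox f g) :
    UniformApprox (fun τ s => τ⁻¹ • f τ s) fun _ => (0 : E) := by
  have hbdd : (fun z : ℝ × ℝ => f z.1 z.2) =O[atTop ×ˢ 𝓟 (Set.Icc (0 : ℝ) 1)]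
      fun _ => (1 : ℝ) := by
    have hone : (fun z : ℝ × ℝ => z.1⁻¹) =O[atTop ×ˢ 𝓟 (Set.Icc (0 : ℝ) 1)]
        fun _ => (1 : ℝ) := (tendsto_inv_atTop_zero.comp tendsto_fst).isBigO_one ℝ
    exact ((h.isBigO.trans hone).add (isBigO_one_of_continuousOn h.continuousOn)).congr_left
      fun z => by abel
  refine ⟨?_, ?_⟩
  · have := (Asymptotics.isBigO_refl (fun z : ℝ × ℝ => z.1⁻¹)
      (atTop ×ˢ 𝓟 (Set.Icc (0 : ℝ) 1))).smul hbdd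
    simpa using this
  · filter_upwards [h.continuousOn_approx] with τ h1 using h1.const_smul _

end General

theorem mul {A : Type*} [NormedRing A] {f f' : ℝ → ℝ → A} {g g' : ℝ → A}
    (h : UniformApprox f g) (h' : UniformApprox f' g') :
    UniformApprox (fun τ s => f τ s * f' τ s) fun s => g s * g' s := by
  have hone : (fun z : ℝ × ℝ => z.1⁻¹) =O[atTop ×ˢ 𝓟 (Set.Icc (0 : ℝ) 1)]
      fun _ => (1 : ℝ) := (tendsto_inv_atTop_zero.comp tendsto_fst).isBigO_one ℝ
  refine ⟨?_, ?_⟩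
  · have h1 := h.isBigO.mul (h'.isBigO.trans hone)
    have h2 := h.isBigO.mul (isBigO_one_of_continuousOn h'.continuousOn)
    have h3 := (isBigO_one_of_continuousOn h.continuousOn).mul h'.isBigO
    simp only [mul_one, one_mul] at h1 h2 h3
    refine ((h1.add h2).add h3).congr_left fun z => ?_
    noncomm_ring
  · filter_upwards [h.continuousOn_approx, h'.continuousOn_approx] with τ h1 h2 using h1.mul h2

section Real

variable {f : ℝ → ℝ → ℝ} {g : ℝ → ℝ}

theorem abs (h : UniformApprox f g) : UniformApprox (fun τ s => |f τ s|) fun s => |g s| := by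
  have hφ : LipschitzWith 1 fun x : ℝ => |x| := lipschitzWith_one_norm
  exact h.lipschitz_comp hφ

theorem integral (h : UniformApprox f g) : ∃ C : ℝ, 0 ≤ C ∧
    ∀ᶠ τ in atTop, |(∫ s in (0 : ℝ)..1, f τ s) - ∫ s in (0 : ℝ)..1, g s| ≤ C / τ := by
  obtain ⟨C, hC, hb⟩ := h.exists_bound
  refine ⟨C, hC, ?_⟩
  filter_upwards [hb, h.continuousOn_approx] with τ h1 h2
  rw [← intervalIntegral.integral_sub
    (h2.intervalIntegrable_of_Icc zero_le_one)
    (h.continuousOn.intervalIntegrable_of_Icc zero_le_one)]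
  have := intervalIntegral.norm_integral_le_of_norm_le_const (a := (0 : ℝ)) (b := 1)
    (f := fun s => f τ s - g s) (C := C / τ) fun s hs => by
      rw [Set.uIoc_of_le zero_le_one] at hs
      exact h1 s (Set.Ioc_subset_Icc_self hs)
  simpa using this

theorem eventually_pos (h : UniformApprox f g) (hg : ∀ s ∈ Set.Icc (0 : ℝ) 1, 0 < g s) :
    ∀ᶠ τ in atTop, ∀ s ∈ Set.Icc (0 : ℝ) 1, 0 < f τ s := by
  obtain ⟨s₀, hs₀, hmin⟩ := isCompact_Icc.exists_isMinOn
    (Set.nonempty_Icc.2 (zero_le_one (α := ℝ))) h.continuousOn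
  have := Metric.tendstoUniformlyOn_iff.1 h.tendstoUniformlyOn (g s₀) (hg s₀ hs₀)
  filter_upwards [this] with τ hτ s hs
  have h1 := hτ s hs
  rw [Real.dist_eq] at h1
  have h2 : g s₀ ≤ g s := hmin hs
  linarith [(abs_lt.1 h1).2]

end Real

end UniformApprox

/-! ### The efficiency bound from its asymptotic ingredients -/

/-- With `w = τ P_w = W + O(τ⁻¹)` and the scaled entropy production `y ≥ X - O(τ⁻¹)`, the ratio
`P_w / (P_w + T_c y / τ²)` is at most `1 - T_c X / (W τ) + O(τ⁻²)`. -/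
theorem div_add_le_of_approx {W Tc X C₁ C₂ w y e : ℝ} (hW : 0 < W) (hTc : 0 < Tc) (hX : 0 ≤ X)
    (hC₁ : 0 ≤ C₁) (he : 0 ≤ e) (hw : |w - W| ≤ C₂ * e)
    (hy : X - C₁ * e ≤ y) (hy0 : 0 ≤ y) (hwW : W / 2 ≤ w) :
    w / (w + Tc * y * e) ≤ 1 - Tc * X / W * e +
      (2 * Tc * C₁ / W + 2 * Tc * X * C₂ / W ^ 2 + 4 * Tc ^ 2 * X ^ 2 / W ^ 2) * e ^ 2 := by
  have hw0 : 0 < w := by linarith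
  -- Replacing `y` by a lower bound `y₀ ≤ X` increases the ratio and keeps its square bounded.
  set y₀ := max 0 (X - C₁ * e) with hy₀
  have h1 : 0 ≤ y₀ := le_max_left _ _
  have h2 : X - C₁ * e ≤ y₀ := le_max_right _ _
  have h3 : y₀ ≤ X := max_le hX (by nlinarith)
  have h4 : y₀ ≤ y := max_le hy0 hy
  set r := Tc * y₀ * e / w with hr
  have hr0 : 0 ≤ r := by positivity
  have hstep1 : w / (w + Tc * y * e) ≤ 1 - r + r ^ 2 := by
    have hz : w + Tc * y₀ * e ≤ w + Tc * y * e := by gcongr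
    have hz0 : 0 < w + Tc * y₀ * e := by positivity
    refine (div_le_div_of_nonneg_left hw0.le hz0 hz).trans ?_
    have e1 : w + Tc * y₀ * e = w * (1 + r) := by rw [hr]; field_simp
    rw [e1, div_le_iff₀ (by positivity)]
    have e2 : (1 - r + r ^ 2) * (w * (1 + r)) = w + w * r ^ 3 := by ring
    rw [e2]
    have : 0 ≤ w * r ^ 3 := by positivity
    linarith
  have hinvw : 1 / w ≤ 2 / W := by
    rw [div_le_div_iff₀ hw0 hW]; linarith
  have hr2 : r ^ 2 ≤ 4 * Tc ^ 2 * X ^ 2 / W ^ 2 * e ^ 2 := by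
    have hrle : r ≤ 2 * Tc * X / W * e := by
      calc r = Tc * y₀ * e * (1 / w) := by rw [hr]; ring
        _ ≤ Tc * X * e * (2 / W) := by gcongr
        _ = 2 * Tc * X / W * e := by ring
    calc r ^ 2 ≤ (2 * Tc * X / W * e) ^ 2 := by gcongr
      _ = 4 * Tc ^ 2 * X ^ 2 / W ^ 2 * e ^ 2 := by ring
  have hC₂e : 0 ≤ C₂ * e := (abs_nonneg _).trans hw
  have hdiff : 1 / W - 1 / w ≤ 2 * C₂ * e / W ^ 2 := by
    have e3 : 1 / W - 1 / w = (w - W) * (1 / w) * (1 / W) := by field_simp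
    rw [e3]
    calc (w - W) * (1 / w) * (1 / W) ≤ (C₂ * e) * (2 / W) * (1 / W) := by
          have := (le_abs_self _).trans hw
          gcongr
      _ = 2 * C₂ * e / W ^ 2 := by ring
  have hr1 : Tc * X / W * e - (2 * Tc * C₁ / W + 2 * Tc * X * C₂ / W ^ 2) * e ^ 2 ≤ r := by
    have h5 : Tc * e * (1 / w) * (X - C₁ * e) ≤ r := by
      calc Tc * e * (1 / w) * (X - C₁ * e) ≤ Tc * e * (1 / w) * y₀ := by gcongr
        _ = r := by rw [hr]; ring
    have h6 : Tc * e * X * (1 / W - 1 / w) ≤ Tc * e * X * (2 * C₂ * e / W ^ 2) := by gcongr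
    have h7 : Tc * e * C₁ * e * (1 / w) ≤ Tc * e * C₁ * e * (2 / W) := by gcongr
    have e4 : Tc * X / W * e - (2 * Tc * C₁ / W + 2 * Tc * X * C₂ / W ^ 2) * e ^ 2 =
        Tc * e * X * (1 / W) - Tc * e * C₁ * e * (2 / W) - Tc * e * X * (2 * C₂ * e / W ^ 2) := by
      ring
    have e5 : Tc * e * (1 / w) * (X - C₁ * e) =
        Tc * e * X * (1 / w) - Tc * e * C₁ * e * (1 / w) := by ring
    rw [e4]
    rw [e5] at h5
    linarith
  linarith

/-! ### Approximation through the Lindblad generator -/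

section LindbladianLinear

variable {n K : Type*} [Fintype n] [Fintype K]

theorem lindbladian_smul_sub (H : Matrix n n ℂ) (L : K → Matrix n n ℂ) (r : ℝ)
    (A B : Matrix n n ℂ) :
    lindbladian H L (r • (A - B)) = r • lindbladian H L A - r • lindbladian H L B := by
  have hc : ∀ X : Matrix n n ℂ, r • X = (r : ℂ) • X := fun X => (Complex.coe_smul r X).symm
  have hd : ∀ k, dissipator (L k) (r • (A - B)) =
      r • dissipator (L k) A - r • dissipator (L k) B := by
    intro k
    simp only [dissipator, hc, Matrix.mul_smul, Matrix.smul_mul, Matrix.mul_sub, Matrix.sub_mul]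
    module
  simp only [lindbladian, hd, Finset.sum_sub_distrib, ← Finset.smul_sum]
  simp only [hc, Matrix.mul_smul, Matrix.smul_mul, Matrix.mul_sub, Matrix.sub_mul]
  module

theorem continuous_lindbladian {H : ℝ → Matrix n n ℂ} {L : K → ℝ → Matrix n n ℂ}
    {ρ : ℝ → Matrix n n ℂ} (hH : Continuous H) (hL : ∀ k, Continuous (L k)) (hρ : Continuous ρ) :
    Continuous fun s => lindbladian (H s) (fun k => L k s) (ρ s) := by
  unfold lindbladian dissipator
  fun_prop

end LindbladianLinear

namespace UniformApprox

variable {n K : Type*} [Fintype n] [Fintype K] {A B : ℝ → ℝ → Matrix n n ℂ}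
  {a b : ℝ → Matrix n n ℂ}

theorem matrix_mul (h : UniformApprox A a) (h' : UniformApprox B b) :
    UniformApprox (fun τ s => A τ s * B τ s) fun s => a s * b s := by
  classical exact h.mul h'

theorem conjTranspose (h : UniformApprox A a) :
    UniformApprox (fun τ s => (A τ s)ᴴ) fun s => (a s)ᴴ := by
  refine h.lipschitz_comp (c := 1) (φ := fun M => Mᴴ) (LipschitzWith.of_dist_le_mul fun M N => ?_)
  rw [dist_eq_norm, dist_eq_norm, ← Matrix.conjTranspose_sub, Matrix.frobenius_norm_conjTranspose]
  simp

theorem complex_smul (h : UniformApprox A a) (c : ℂ) :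
    UniformApprox (fun τ s => c • A τ s) fun s => c • a s :=
  h.lipschitz_comp (lipschitzWith_smul c)

theorem trace_re (h : UniformApprox A a) :
    UniformApprox (fun τ s => ((A τ s).trace).re) fun s => ((a s).trace).re :=
  h.linear_comp (Complex.reLm ∘ₗ Matrix.traceLinearMap n ℝ ℂ)

theorem apply_re (h : UniformApprox A a) (i j : n) :
    UniformApprox (fun τ s => (A τ s i j).re) fun s => (a s i j).re :=
  h.linear_comp (Complex.reLm ∘ₗ Matrix.entryLinearMap ℝ ℂ i j)

theorem lindbladian (h : UniformApprox A a) {H : ℝ → Matrix n n ℂ} {L : K → ℝ → Matrix n n ℂ}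
    (hH : Continuous H) (hL : ∀ k, Continuous (L k)) :
    UniformApprox (fun τ s => HeatEngine.lindbladian (H s) (fun k => L k s) (A τ s))
      fun s => HeatEngine.lindbladian (H s) (fun k => L k s) (a s) := by
  have cH : UniformApprox (fun _ => H) H := const hH.continuousOn
  have cL : ∀ k, UniformApprox (fun _ => L k) (L k) := fun k => const (hL k).continuousOn
  refine (((cH.matrix_mul h).sub (h.matrix_mul cH)).complex_smul _).add (sum _ fun k _ => ?_)
  have cLL := (cL k).conjTranspose.matrix_mul (cL k)
  exact (((cL k).matrix_mul h).matrix_mul (cL k).conjTranspose).sub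
    (((cLL.matrix_mul h).add (h.matrix_mul cLL)).complex_smul _)

end UniformApprox

/-! ### The Gibbs path of a protocol -/

namespace Protocol

variable {n K : Type*} [Fintype n] [DecidableEq n] [Fintype K] (P : Protocol n K)

theorem H_continuous : Continuous P.H := P.H_contDiff.continuous

theorem α_continuous : Continuous P.α := P.α_contDiff.continuous

theorem Th_pos : 0 < P.Th := P.Tc_pos.trans P.Tc_lt_Th

theorem carnot_pos : 0 < P.carnot :=
  sub_pos.2 ((div_lt_one P.Th_pos).2 P.Tc_lt_Th)

theorem inv_temp (s : ℝ) : (P.temp s)⁻¹ = (1 - P.α s * P.carnot) / P.Tc := by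
  have h1 := P.Tc_pos.ne'
  have h2 := P.Th_pos.ne'
  rw [temp, inv_div, carnot]
  field_simp
  ring

theorem continuous_inv_temp : Continuous fun s => (P.temp s)⁻¹ := by
  simp only [inv_temp]
  exact (continuous_const.sub (P.α_continuous.mul continuous_const)).div_const _

theorem gibbsPath_posDef [Nonempty n] (s : ℝ) : (P.gibbsPath s).PosDef :=
  gibbs_posDef (P.H_hermitian s) _

theorem continuous_gibbsPath [Nonempty n] : Continuous P.gibbsPath := by
  have h1 : Continuous fun s => NormedSpace.exp (-((P.temp s)⁻¹ • P.H s)) :=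
    NormedSpace.exp_continuous.comp (P.continuous_inv_temp.smul P.H_continuous).neg
  refine (Continuous.inv₀ h1.matrix_trace fun s => ?_).smul h1
  exact (posDef_exp_of_isHermitian
    (isHermitian_neg_smul (P.H_hermitian s) (P.temp s)⁻¹)).trace_pos.ne'

theorem lindbladian_gibbsPath (s : ℝ) :
    lindbladian (P.H s) (fun k => P.L k s) (P.gibbsPath s) = 0 := by
  refine lindbladian_eq_zero_of_detailed_balance P.pair_involutive
    (θ := fun k => (P.temp s)⁻¹ * P.ω k s) (fun k => ?_) (commute_gibbs _ _)
    (fun k => gibbs_mul_jump (P.energy_change k s) _) fun k => P.detailed_balance k s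
  rw [P.ω_pair]
  ring

end Protocol

/-! ### Cyclic states in rescaled time -/

namespace Protocol

variable {n K : Type*} [Fintype n] [DecidableEq n] [Fintype K] (P : Protocol n K)

/-- The rate of change `d/ds ρ(τ s)` of a state in rescaled time, as given by the Lindblad
equation. -/
def rescaledRate (τ : ℝ) (ρ : ℝ → Matrix n n ℂ) (s : ℝ) : Matrix n n ℂ :=
  τ • lindbladian (P.H s) (fun k => P.L k s) (ρ (τ * s))

variable {P}

namespace IsCyclicState

variable {τ : ℝ} {ρ : ℝ → Matrix n n ℂ}

theorem continuous (h : P.IsCyclicState τ ρ) : Continuous ρ :=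
  continuous_iff_continuousAt.2 fun t => (h.lindblad t).continuousAt

theorem continuous_rescaled (h : P.IsCyclicState τ ρ) : Continuous fun s => ρ (τ * s) :=
  h.continuous.comp (continuous_const.mul continuous_id)

theorem continuous_rescaledRate (h : P.IsCyclicState τ ρ) : Continuous (P.rescaledRate τ ρ) :=
  (continuous_lindbladian P.H_continuous P.L_continuous h.continuous_rescaled).const_smul τ

theorem hasDerivAt_rescaled (h : P.IsCyclicState τ ρ) (hτ : 0 < τ) (s : ℝ) :
    HasDerivAt (fun s => ρ (τ * s)) (P.rescaledRate τ ρ s) s := by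
  have h1 := h.lindblad (τ * s)
  rw [mul_div_cancel_left₀ s hτ.ne'] at h1
  have h2 : HasDerivAt (fun s => τ * s) τ s := by simpa using (hasDerivAt_id s).const_mul τ
  exact h1.scomp s h2

theorem heatSupply_eq (h : P.IsCyclicState τ ρ) (hτ : 0 < τ) (a : ℝ → ℝ) :
    heatSupply τ (fun t => a (t / τ)) (fun t => P.H (t / τ)) ρ =
      τ⁻¹ * ∫ s in (0 : ℝ)..1, a s * ((P.H s * P.rescaledRate τ ρ s).trace).re := by
  have h1 := intervalIntegral.mul_integral_comp_mul_left (a := (0 : ℝ)) (b := 1)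
    (f := fun t => a (t / τ) * heatRate (fun t => P.H (t / τ)) ρ t) (c := τ)
  rw [mul_zero, mul_one] at h1
  rw [heatSupply, ← h1, ← intervalIntegral.integral_const_mul]
  congr 1
  refine intervalIntegral.integral_congr fun s _ => ?_
  have h2 : deriv ρ (τ * s) = lindbladian (P.H s) (fun k => P.L k s) (ρ (τ * s)) := by
    have := (h.lindblad (τ * s)).deriv
    rwa [mul_div_cancel_left₀ s hτ.ne'] at this
  simp only [heatRate, rescaledRate, mul_div_cancel_left₀ s hτ.ne', h2, Matrix.mul_smul,
    Matrix.trace_smul, Complex.smul_re, smul_eq_mul]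
  ring

theorem meanHeat_eq (h : P.IsCyclicState τ ρ) (hτ : 0 < τ) :
    P.meanHeat τ ρ =
      τ⁻¹ * ∫ s in (0 : ℝ)..1, P.α s * ((P.H s * P.rescaledRate τ ρ s).trace).re :=
  h.heatSupply_eq hτ P.α

/-- First law over a cycle: the extracted work equals the absorbed heat. -/
theorem workPower_eq (h : P.IsCyclicState τ ρ) (hτ : 0 < τ) :
    workPower τ (fun t => P.H (t / τ)) ρ =
      τ⁻¹ * ∫ s in (0 : ℝ)..1, ((P.H s * P.rescaledRate τ ρ s).trace).re := by
  have hheat := h.heatSupply_eq hτ fun _ => 1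
  simp only [one_mul, heatSupply] at hheat
  rw [← hheat, workPower, neg_mul, ← mul_neg, ← intervalIntegral.integral_neg]
  congr 1
  rw [← sub_eq_zero]
  have hHτ : ContDiff ℝ 1 fun t => P.H (t / τ) := P.H_contDiff.comp (contDiff_id.div_const τ)
  have hdH : ∀ t, HasDerivAt (fun t => P.H (t / τ)) (deriv (fun t => P.H (t / τ)) t) t :=
    fun t => (hHτ.differentiable one_ne_zero t).hasDerivAt
  have hcH : Continuous (deriv fun t => P.H (t / τ)) := hHτ.continuous_deriv le_rfl
  have hdρ : ∀ t, HasDerivAt ρ (deriv ρ t) t := fun t => (h.lindblad t).differentiableAt.hasDerivAt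
  have hcρ : Continuous (deriv ρ) := by
    have : deriv ρ = fun t => lindbladian (P.H (t / τ)) (fun k => P.L k (t / τ)) (ρ t) :=
      funext fun t => (h.lindblad t).deriv
    rw [this]
    exact continuous_lindbladian hHτ.continuous
      (fun k => (P.L_continuous k).comp (continuous_id.div_const τ)) h.continuous
  have c1 : Continuous fun t => ((deriv (fun t => P.H (t / τ)) t * ρ t).trace).re :=
    Complex.continuous_re.comp (hcH.matrix_mul h.continuous).matrix_trace
  have c2 : Continuous fun t => heatRate (fun t => P.H (t / τ)) ρ t :=
    Complex.continuous_re.comp (hHτ.continuous.matrix_mul hcρ).matrix_trace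
  have hd : ∀ t, HasDerivAt (fun t => ((P.H (t / τ) * ρ t).trace).re)
      (((deriv (fun t => P.H (t / τ)) t * ρ t).trace).re +
        heatRate (fun t => P.H (t / τ)) ρ t) t := by
    intro t
    let φ : Matrix n n ℂ →L[ℝ] ℝ :=
      LinearMap.toContinuousLinearMap (Complex.reLm ∘ₗ Matrix.traceLinearMap n ℝ ℂ)
    have h1 := φ.hasFDerivAt.comp_hasDerivAt t ((hdH t).mul (hdρ t))
    have e : φ (deriv (fun t => P.H (t / τ)) t * ρ t + P.H (t / τ) * deriv ρ t) =
        ((deriv (fun t => P.H (t / τ)) t * ρ t).trace).re +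
          heatRate (fun t => P.H (t / τ)) ρ t := by
      rw [map_add]
      rfl
    exact h1.congr_deriv e
  have hI := intervalIntegral.integral_eq_sub_of_hasDerivAt (a := (0 : ℝ)) (b := τ)
    (fun t _ => hd t) ((c1.add c2).intervalIntegrable _ _)
  have hend : ((P.H (τ / τ) * ρ τ).trace).re = ((P.H (0 / τ) * ρ 0).trace).re := by
    have e1 : P.H (τ / τ) = P.H (0 / τ) := by
      rw [div_self hτ.ne', zero_div]
      simpa using P.H_periodic 0
    have e2 : ρ τ = ρ 0 := by simpa using h.periodic 0
    rw [e1, e2]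
  rw [hend, sub_self, intervalIntegral.integral_add (c1.intervalIntegrable _ _)
    (c2.intervalIntegrable _ _)] at hI
  rw [intervalIntegral.integral_neg]
  linarith

/-- Second law in speed-limit form, integrated over a cycle along which the state has full rank.
The entropy of the system contributes nothing because the state is periodic. -/
theorem cycle_speed_limit (h : P.IsCyclicState τ ρ) (hτ : 0 < τ) {p : ℝ → n → ℝ}
    {U : ℝ → Matrix n n ℂ} (hdec : IsEigenDecomposition (fun s => ρ (τ * s)) p U)
    (hU : ContinuousOn U (Set.Icc 0 1)) (hp : ∀ s ∈ Set.Icc (0 : ℝ) 1, ∀ i, 0 < p s i)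
    {x : ℝ} (hx : 0 ≤ x) :
    x * (∫ s in (0 : ℝ)..1, ∑ i, |(((U s)ᴴ * P.rescaledRate τ ρ s * U s) i i).re|) -
        x ^ 2 / 2 * (∫ s in (0 : ℝ)..1,
          ∑ k, ((P.L k s * ρ (τ * s) * (P.L k s)ᴴ).trace).re) ≤
      -(τ * ∫ s in (0 : ℝ)..1,
        (P.temp s)⁻¹ * ((P.H s * P.rescaledRate τ ρ s).trace).re) := by
  have hg := h.continuous_rescaledRate
  have hR := h.continuous_rescaled
  set v : ℝ → n → ℝ := fun s i => (((U s)ᴴ * P.rescaledRate τ ρ s * U s) i i).re with hv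
  have hvc : ∀ i, ContinuousOn (fun s => v s i) (Set.Icc 0 1) := fun i =>
    (Complex.continuous_re.comp (continuous_id.matrix_elem i i)).comp_continuousOn
      (((continuous_id.matrix_conjTranspose.comp_continuousOn hU).mul hg.continuousOn).mul hU)
  have hpc : ∀ i, ContinuousOn (fun s => p s i) (Set.Icc 0 1) := fun i =>
    hdec.continuousOn hU hR.continuousOn i
  have hlc : ∀ i, ContinuousOn (fun s => Real.log (p s i)) (Set.Icc 0 1) := fun i =>
    (hpc i).log fun s hs => (hp s hs i).ne'
  have hSc : ContinuousOn (fun s => ∑ i, v s i * Real.log (p s i)) (Set.Icc 0 1) :=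
    continuousOn_finsetSum _ fun i _ => (hvc i).mul (hlc i)
  have hAc : Continuous fun s => ∑ k, ((P.L k s * ρ (τ * s) * (P.L k s)ᴴ).trace).re :=
    continuous_finsetSum _ fun k _ => Complex.continuous_re.comp
      (((P.L_continuous k).matrix_mul hR).matrix_mul
        (P.L_continuous k).matrix_conjTranspose).matrix_trace
  have hqc : Continuous fun s => (P.temp s)⁻¹ * ((P.H s * P.rescaledRate τ ρ s).trace).re :=
    P.continuous_inv_temp.mul
      (Complex.continuous_re.comp (P.H_continuous.matrix_mul hg).matrix_trace)
  have hVc : ContinuousOn (fun s => ∑ i, |v s i|) (Set.Icc 0 1) :=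
    continuousOn_finsetSum _ fun i _ => (hvc i).abs
  -- `∑ p (log p - 1)` is a primitive of `∑ ṗ log p` and takes equal values at `0` and `1`.
  have hS : ∫ s in (0 : ℝ)..1, ∑ i, v s i * Real.log (p s i) = 0 := by
    have h0 : (0 : ℝ) ∈ Set.Icc (0 : ℝ) 1 := by simp
    have h1 : (1 : ℝ) ∈ Set.Icc (0 : ℝ) 1 := by simp
    rw [intervalIntegral.integral_eq_sub_of_hasDerivAt_of_le zero_le_one
      (f := fun s => ∑ i, (p s i * Real.log (p s i) - p s i)) ?_ ?_
      (hSc.intervalIntegrable_of_Icc zero_le_one)]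
    · rw [sub_eq_zero]
      refine sum_eq_of_unitary_conj_diagonal_eq (hdec 1 h1).1 (hdec 0 h0).1 ?_
        fun q => q * Real.log q - q
      rw [← (hdec 1 h1).2, ← (hdec 0 h0).2]
      simpa using h.periodic 0
    · exact continuousOn_finsetSum _ fun i _ => ((hpc i).mul (hlc i)).sub (hpc i)
    · intro s hs
      refine HasDerivAt.fun_sum fun i _ => ?_
      have hps := hp s (Set.Ioo_subset_Icc_self hs) i
      have hd := hdec.hasDerivAt hU hs (h.hasDerivAt_rescaled hτ s) i
      have hd2 := (hd.mul (hd.log hps.ne')).sub hd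
      refine hd2.congr_deriv ?_
      field_simp
      ring
  have hpt : ∀ s ∈ Set.Icc (0 : ℝ) 1, x * ∑ i, |v s i| -
      x ^ 2 / 2 * ∑ k, ((P.L k s * ρ (τ * s) * (P.L k s)ᴴ).trace).re ≤
      -τ * (∑ i, v s i * Real.log (p s i)) -
        τ * ((P.temp s)⁻¹ * ((P.H s * P.rescaledRate τ ρ s).trace).re) := by
    intro s hs
    have hlim := lindbladian_speed_limit P.pair_involutive (P.H_hermitian s)
      (L := fun k => P.L k s) (ω := fun k => P.ω k s) (fun k => P.ω_pair k s)
      (fun k => P.energy_change k s) (β := (P.temp s)⁻¹) (fun k => P.detailed_balance k s)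
      (hdec s hs).1 (hp s hs) (hdec s hs).2 (x := x / τ) (by positivity)
    have hlim2 := mul_le_mul_of_nonneg_left hlim (sq_nonneg τ)
    have ev : ∀ i, v s i =
        τ * (((U s)ᴴ * lindbladian (P.H s) (fun k => P.L k s) (ρ (τ * s)) * U s) i i).re := by
      intro i
      simp only [hv, rescaledRate, Matrix.mul_smul, Matrix.smul_mul, Matrix.smul_apply,
        Complex.smul_re, smul_eq_mul]
    have eq : ((P.H s * P.rescaledRate τ ρ s).trace).re =
        τ * ((P.H s * lindbladian (P.H s) (fun k => P.L k s) (ρ (τ * s))).trace).re := by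
      simp only [rescaledRate, Matrix.mul_smul, Matrix.trace_smul, Complex.smul_re, smul_eq_mul]
    simp only [ev, eq, abs_mul, abs_of_pos hτ, mul_assoc τ, ← Finset.mul_sum]
    refine le_trans (le_of_eq ?_) (hlim2.trans (le_of_eq ?_))
    · field_simp
    · ring
  have i1 := hVc.intervalIntegrable_of_Icc (μ := volume) zero_le_one
  have i2 := hAc.continuousOn.intervalIntegrable_of_Icc (μ := volume) (zero_le_one (α := ℝ))
  have i3 := hSc.intervalIntegrable_of_Icc (μ := volume) zero_le_one
  have i4 := hqc.continuousOn.intervalIntegrable_of_Icc (μ := volume) (zero_le_one (α := ℝ))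
  have hI := intervalIntegral.integral_mono_on zero_le_one
    ((i1.const_mul x).sub (i2.const_mul (x ^ 2 / 2))) ((i3.const_mul (-τ)).sub (i4.const_mul τ)) hpt
  rw [intervalIntegral.integral_sub (i1.const_mul x) (i2.const_mul _),
    intervalIntegral.integral_sub (i3.const_mul _) (i4.const_mul τ)] at hI
  simp only [intervalIntegral.integral_const_mul] at hI
  rw [hS] at hI
  simpa using hI

end IsCyclicState

end Protocol

/-! ### Length of a curve with differentiable eigenvalues -/

/-- A curve of matrices with `C¹` eigenvalues has a Wasserstein length, and the total motion of the
eigenvalues bounds it. -/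
theorem IsEigenDecomposition.exists_length {n : Type*} [Fintype n] [DecidableEq n]
    {A : ℝ → Matrix n n ℂ} {p : ℝ → n → ℝ} {U : ℝ → Matrix n n ℂ}
    (hdec : IsEigenDecomposition A p U) (hp : ∀ i, ContinuousOn (fun s => p s i) (Set.Icc 0 1))
    {D : ℝ → n → ℝ} (hD : ∀ i, ContinuousOn (fun s => D s i) (Set.Icc 0 1))
    (hpD : ∀ i, ∀ s ∈ Set.Ioo (0 : ℝ) 1, HasDerivAt (fun t => p t i) (D s i) s) :
    ∃ ℓ : ℝ, 0 ≤ ℓ ∧ IsGeometricLength wasserstein 1 A ℓ ∧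
      ℓ ≤ (1 / 2) * ∫ s in (0 : ℝ)..1, ∑ i, |D s i| := by
  have hsub : ∀ {s t : ℝ}, s ∈ Set.Icc (0 : ℝ) 1 → t ∈ Set.Icc (0 : ℝ) 1 →
      Set.Icc s t ⊆ Set.Icc 0 1 := fun hs ht => Set.Icc_subset_Icc hs.1 ht.2
  have hvc : ContinuousOn (fun s => ∑ i, |D s i|) (Set.Icc 0 1) :=
    continuousOn_finsetSum _ fun i _ => (hD i).abs
  have hW : ∀ s ∈ Set.Icc (0 : ℝ) 1, ∀ t ∈ Set.Icc (0 : ℝ) 1, s ≤ t →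
      wasserstein (A s) (A t) ≤ (1 / 2) * ∫ r in s..t, ∑ i, |D r i| := by
    intro s hs t ht hst
    rw [(hdec s hs).2, (hdec t ht).2]
    refine (wasserstein_le (hdec s hs).1 (hdec t ht).1 _ _).trans ?_
    refine mul_le_mul_of_nonneg_left ?_ (by norm_num)
    rw [intervalIntegral.integral_finsetSum fun i _ =>
      ((hD i).abs.mono (hsub hs ht)).intervalIntegrable_of_Icc hst]
    refine Finset.sum_le_sum fun i _ => ?_
    have hint := ((hD i).mono (hsub hs ht)).intervalIntegrable_of_Icc (μ := volume) hst
    have h1 := intervalIntegral.integral_eq_sub_of_hasDerivAt_of_le hst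
      ((hp i).mono (hsub hs ht))
      (fun r hr => hpD i r ⟨hs.1.trans_lt hr.1, hr.2.trans_le ht.2⟩) hint
    rw [abs_sub_comm, ← h1]
    exact intervalIntegral.abs_integral_le_integral_abs hst
  obtain ⟨M, hM⟩ := isCompact_Icc.exists_bound_of_continuousOn hvc
  have hM0 : 0 ≤ M := (norm_nonneg _).trans (hM 0 (by simp))
  have hcoord : ∀ (s t : ℝ) j, |sortedEigenvalues (A s) j - sortedEigenvalues (A t) j| ≤
      2 * wasserstein (A s) (A t) := by
    intro s t j
    rw [wasserstein, ← mul_assoc]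
    norm_num
    exact Finset.single_le_sum (f := fun j => |sortedEigenvalues (A s) j -
      sortedEigenvalues (A t) j|) (fun _ _ => abs_nonneg _) (Finset.mem_univ j)
  have hlip : ∀ j, LipschitzOnWith M.toNNReal (fun s => sortedEigenvalues (A s) j)
      (Set.Icc 0 1) := by
    intro j
    have key : ∀ s ∈ Set.Icc (0 : ℝ) 1, ∀ t ∈ Set.Icc (0 : ℝ) 1, s ≤ t →
        |sortedEigenvalues (A s) j - sortedEigenvalues (A t) j| ≤ M * |s - t| := by
      intro s hs t ht hst
      have h1 := hcoord s t j
      have h2 := hW s hs t ht hst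
      have h3 := intervalIntegral.norm_integral_le_of_norm_le_const (a := s) (b := t)
        (f := fun r => ∑ i, |D r i|) (C := M) fun r hr => by
          rw [Set.uIoc_of_le hst] at hr
          exact hM r (hsub hs ht (Set.Ioc_subset_Icc_self hr))
      have h4 := (le_abs_self _).trans h3
      rw [abs_sub_comm s t]
      linarith
    refine LipschitzOnWith.of_dist_le_mul fun s hs t ht => ?_
    rw [Real.dist_eq, Real.dist_eq, Real.coe_toNNReal _ hM0]
    rcases le_total s t with h | h
    · exact key s hs t ht h
    · rw [abs_sub_comm, abs_sub_comm s]
      exact key t ht s hs h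
  have hbv : ∀ j, BoundedVariationOn (fun s => sortedEigenvalues (A s) j) (Set.Icc 0 1) := by
    intro j
    have := (hlip j).locallyBoundedVariationOn 0 1 (by simp) (by simp)
    rwa [Set.inter_self] at this
  let ℓ : ℝ := (1 / 2) * ∑ j,
    (eVariationOn (fun s => sortedEigenvalues (A s) j) (Set.Icc 0 1)).toReal
  have hlen : IsGeometricLength wasserstein 1 A ℓ := by
    have h1 := (tendsto_finsetSum Finset.univ fun j _ =>
      tendsto_sum_abs_uniform_partition (hlip j).continuousOn (hbv j)).const_mul (1 / 2 : ℝ)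
    refine h1.congr fun N => ?_
    rw [Finset.sum_comm, Finset.mul_sum]
    rfl
  refine ⟨ℓ, by positivity, hlen, le_of_tendsto hlen ?_⟩
  filter_upwards [eventually_gt_atTop 0] with N hN
  have hN' : (0 : ℝ) < N := by exact_mod_cast hN
  have hmem : ∀ k ≤ N, (k : ℝ) * (1 / N) ∈ Set.Icc (0 : ℝ) 1 := by
    intro k hk
    have hk' : (k : ℝ) ≤ N := by exact_mod_cast hk
    refine ⟨by positivity, ?_⟩
    rw [mul_one_div]
    exact (div_le_one hN').2 hk'
  have hstep : ∀ k : ℕ, (k : ℝ) * (1 / N) ≤ ((k + 1 : ℕ) : ℝ) * (1 / N) := by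
    intro k
    gcongr
    exact k.le_succ
  have hadj := intervalIntegral.sum_integral_adjacent_intervals (μ := volume)
    (f := fun s => ∑ i, |D s i|) (a := fun k : ℕ => (k : ℝ) * (1 / N)) (n := N) fun k hk =>
      (hvc.mono (hsub (hmem k hk.le) (hmem (k + 1) hk))).intervalIntegrable_of_Icc (hstep k)
  have hend : (N : ℝ) * (1 / N) = 1 := by field_simp
  simp only [Nat.cast_zero, zero_mul, hend] at hadj
  rw [← hadj, Finset.mul_sum]
  refine Finset.sum_le_sum fun k hk => ?_
  rw [Finset.mem_range] at hk
  have h1 := hW _ (hmem k hk.le) _ (hmem (k + 1) hk) (hstep k)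
  push_cast at h1 ⊢
  exact h1

/-! ### The quasistatic limit -/

theorem trace_jump_nonneg {n : Type*} [Fintype n] [DecidableEq n] {U : Matrix n n ℂ}
    (hU : U ∈ Matrix.unitaryGroup n ℂ) {p : n → ℝ} (hp : ∀ i, 0 < p i) (L : Matrix n n ℂ) :
    0 ≤ ((L * (U * Matrix.diagonal (fun i => (p i : ℂ)) * Uᴴ) * Lᴴ).trace).re := by
  rw [trace_unitary_conj_activity hU]
  exact Finset.sum_nonneg fun i _ => Finset.sum_nonneg fun j _ =>
    mul_nonneg (Complex.normSq_nonneg _) (hp j).le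

theorem eq_zero_of_trace_jump_eq_zero {n : Type*} [Fintype n] [DecidableEq n] {U : Matrix n n ℂ}
    (hU : U ∈ Matrix.unitaryGroup n ℂ) {p : n → ℝ} (hp : ∀ i, 0 < p i) {L : Matrix n n ℂ}
    (h : ((L * (U * Matrix.diagonal (fun i => (p i : ℂ)) * Uᴴ) * Lᴴ).trace).re = 0) : L = 0 := by
  rw [trace_unitary_conj_activity hU] at h
  have hnn : ∀ i j, 0 ≤ Complex.normSq ((Uᴴ * L * U) i j) * p j := fun i j =>
    mul_nonneg (Complex.normSq_nonneg _) (hp j).le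
  have h0 : Uᴴ * L * U = 0 := by
    ext i j
    have h1 := (Finset.sum_eq_zero_iff_of_nonneg fun i _ =>
      Finset.sum_nonneg fun j _ => hnn i j).1 h i (Finset.mem_univ i)
    have h2 := (Finset.sum_eq_zero_iff_of_nonneg fun j _ => hnn i j).1 h1 j (Finset.mem_univ j)
    exact Complex.normSq_eq_zero.1 ((mul_eq_zero.1 h2).resolve_right (hp j).ne')
  have h2 : U * Uᴴ = 1 := Matrix.mem_unitaryGroup_iff.1 hU
  calc L = U * Uᴴ * L * (U * Uᴴ) := by rw [h2, one_mul, mul_one]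
    _ = U * (Uᴴ * L * U) * Uᴴ := by simp only [mul_assoc]
    _ = 0 := by rw [h0, mul_zero, zero_mul]

theorem IsEigenDecomposition.pos_of_posDef {n : Type*} [Fintype n] [DecidableEq n]
    {A : ℝ → Matrix n n ℂ} {p : ℝ → n → ℝ} {U : ℝ → Matrix n n ℂ}
    (hdec : IsEigenDecomposition A p U) {s : ℝ} (hs : s ∈ Set.Icc (0 : ℝ) 1)
    (hA : (A s).PosDef) (i : n) : 0 < p s i := by
  rw [hdec.eigenvalue_eq hs i]
  have hU : IsUnit (U s) := by
    refine IsUnit.of_mul_eq_one (U s)ᴴ ?_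
    exact Matrix.mem_unitaryGroup_iff.1 (hdec s hs).1
  have h := (hA.conjTranspose_mul_mul_same (Matrix.mulVec_injective_of_isUnit hU)).diag_pos (i := i)
  exact (Complex.pos_iff.1 h).1

namespace Protocol

variable {n K : Type*} [Fintype n] [DecidableEq n] [Fintype K] {P : Protocol n K}

/-- The Gibbs state has full rank, so every nonzero jump operator contributes to the activity. -/
theorem quasistaticActivity_pos [Nonempty n] {p : ℝ → n → ℝ} {U : ℝ → Matrix n n ℂ}
    (hdec : IsEigenDecomposition P.gibbsPath p U)
    (hL : ∃ s ∈ Set.Icc (0 : ℝ) 1, ∃ k, P.L k s ≠ 0) : 0 < P.quasistaticActivity := by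
  have hp : ∀ s ∈ Set.Icc (0 : ℝ) 1, ∀ i, 0 < p s i := fun s hs i =>
    hdec.pos_of_posDef hs (P.gibbsPath_posDef s) i
  have hnn : ∀ s ∈ Set.Icc (0 : ℝ) 1, ∀ k,
      0 ≤ ((P.L k s * P.gibbsPath s * (P.L k s)ᴴ).trace).re := by
    intro s hs k
    rw [(hdec s hs).2]
    exact trace_jump_nonneg (hdec s hs).1 (hp s hs) _
  have hc : Continuous fun s => ∑ k, ((P.L k s * P.gibbsPath s * (P.L k s)ᴴ).trace).re :=
    continuous_finsetSum _ fun k _ => Complex.continuous_re.comp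
      (((P.L_continuous k).matrix_mul P.continuous_gibbsPath).matrix_mul
        (P.L_continuous k).matrix_conjTranspose).matrix_trace
  rw [quasistaticActivity, activity, inv_one, one_mul]
  refine intervalIntegral.integral_pos zero_lt_one hc.continuousOn
    (fun s hs => Finset.sum_nonneg fun k _ => hnn s (Set.Ioc_subset_Icc_self hs) k) ?_
  obtain ⟨s, hs, k, hk⟩ := hL
  refine ⟨s, hs, lt_of_lt_of_le (lt_of_le_of_ne (hnn s hs k) fun h0 => hk ?_)
    (Finset.single_le_sum (fun k _ => hnn s hs k) (Finset.mem_univ k))⟩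
  rw [(hdec s hs).2] at h0
  exact eq_zero_of_trace_jump_eq_zero (hdec s hs).1 (hp s hs) h0.symm

/-- The first-order expansion of the states already controls their rates of change: stationarity of
the Gibbs state cancels the factor `τ` in the rescaled Lindblad equation. -/
theorem exists_uniformApprox [Nonempty n] {ρ : ℝ → ℝ → Matrix n n ℂ}
    (hρ : ∀ τ : ℝ, 0 < τ → P.IsCyclicState τ (ρ τ)) {c : ℕ → ℝ → Matrix n n ℂ}
    (hc0 : ∀ s ∈ Set.Icc (0 : ℝ) 1, c 0 s = P.gibbsPath s)
    (hexp : HasExpansion 1 (fun τ s => ρ τ (τ * s)) c) :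
    UniformApprox (fun τ s => ρ τ (τ * s)) P.gibbsPath ∧
    UniformApprox (fun τ => P.rescaledRate τ (ρ τ))
      (fun s => lindbladian (P.H s) (fun k => P.L k s) (c 1 s)) := by
  have hπ := P.continuous_gibbsPath
  obtain ⟨C, τ₀, hτ₀, hb⟩ := hexp
  have hf : UniformApprox (fun τ s => τ • (ρ τ (τ * s) - P.gibbsPath s)) (c 1) := by
    refine UniformApprox.of_bound (C := C) (τ₀ := τ₀) (fun τ hτ s hs => ?_) ?_
    · have hτ0 : 0 < τ := hτ₀.trans_le hτ
      have h1 := hb τ hτ s hs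
      simp only [Finset.sum_range_succ, Finset.sum_range_zero, zero_add, pow_zero, inv_one,
        one_smul, pow_one, hc0 s hs] at h1
      have e : τ • (ρ τ (τ * s) - P.gibbsPath s) - c 1 s =
          τ • (ρ τ (τ * s) - (P.gibbsPath s + τ⁻¹ • c 1 s)) := by
        rw [← sub_sub, smul_sub τ (ρ τ (τ * s) - P.gibbsPath s), smul_smul,
          mul_inv_cancel₀ hτ0.ne', one_smul]
      rw [e, norm_smul, Real.norm_of_nonneg hτ0.le]
      calc τ * ‖ρ τ (τ * s) - (P.gibbsPath s + τ⁻¹ • c 1 s)‖ ≤ τ * (C / τ ^ (1 + 1)) := by gcongr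
        _ = C / τ := by field_simp; ring
    · filter_upwards [eventually_gt_atTop 0] with τ hτ
      exact (((hρ τ hτ).continuous_rescaled.sub hπ).const_smul τ).continuousOn
  refine ⟨?_, ?_⟩
  · refine (hf.inv_smul.add (UniformApprox.const hπ.continuousOn)).congr ?_ fun s _ => ?_
    · filter_upwards [eventually_gt_atTop 0] with τ hτ s _
      simp only [smul_smul, inv_mul_cancel₀ hτ.ne', one_smul, sub_add_cancel]
    · exact zero_add _
  · refine (hf.lindbladian P.H_continuous P.L_continuous).congr ?_ fun _ _ => rfl
    filter_upwards with τ s _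
    simp only [lindbladian_smul_sub, lindbladian_gibbsPath, smul_zero, sub_zero, rescaledRate]

end Protocol

end HeatEngine

end

theorem mainTheorem4 {n K : Type*} [Fintype n] [DecidableEq n] [Fintype K]
    (P : HeatEngine.Protocol n K) (ρ : ℝ → ℝ → Matrix n n ℂ)
    (hρ : ∀ τ : ℝ, 0 < τ → P.IsCyclicState τ (ρ τ))
    (hpert : P.HasPerturbativeForm ρ)
    (hwork : 0 < P.quasistaticWork) :
    0 < P.quasistaticActivity ∧
    ∃ ℓ : ℝ, HeatEngine.IsGeometricLength HeatEngine.wasserstein 1 P.gibbsPath ℓ ∧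
      ∃ C τ₁ : ℝ, 0 < τ₁ ∧ ∀ τ : ℝ, τ₁ ≤ τ →
        0 < P.meanHeat τ (ρ τ) ∧
        P.efficiency τ (ρ τ) ≤
          P.carnot * (1 - 2 * P.Tc / P.quasistaticActivity * (ℓ ^ 2 / (P.quasistaticWork * τ)))
            + C / τ ^ 2 := by
  -- A density matrix has trace one, so the Hilbert space is not zero-dimensional.
  have : Nonempty n := by
    by_contra h
    rw [not_nonempty_iff] at h
    have := (hρ 1 one_pos).trace_eq_one 0
    simp [Matrix.trace] at this
  obtain ⟨c, hc0, hexp⟩ := hpert.state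
  obtain ⟨p, U, p', U', hev, hdec', -, C₀, τ₀, hτ₀, hUb⟩ := hpert.eigen
  obtain ⟨hR, hg⟩ := HeatEngine.Protocol.exists_uniformApprox hρ hc0 hexp
  set G : ℝ → Matrix n n ℂ :=
    fun s => HeatEngine.lindbladian (P.H s) (fun k => P.L k s) (c 1 s) with hG
  have hU : HeatEngine.UniformApprox U (U' 0) := by
    refine HeatEngine.UniformApprox.of_bound (C := C₀) (τ₀ := τ₀) (fun τ hτ s hs => ?_)
      (hev.mono fun τ h => h.2)
    simpa using hUb τ hτ s hs
  -- The Gibbs path moves with the limiting rate.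
  have hπG : ∀ s ∈ Set.Ioo (0 : ℝ) 1, HasDerivAt P.gibbsPath (G s) s := by
    intro s hs
    refine hasDerivAt_of_tendstoUniformlyOn (f := fun τ s => ρ τ (τ * s)) isOpen_Ioo
      (hg.tendstoUniformlyOn.mono Set.Ioo_subset_Icc_self) ?_ ?_ hs
    · filter_upwards [eventually_gt_atTop 0] with τ hτ s _
      exact (hρ τ hτ).hasDerivAt_rescaled hτ s
    · exact fun s hs => hR.tendstoUniformlyOn.tendsto_at (Set.Ioo_subset_Icc_self hs)
  have hwork_eq : P.quasistaticWork = ∫ s in (0 : ℝ)..1, ((P.H s * G s).trace).re := by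
    refine intervalIntegral.integral_congr_Ioo_of_le zero_le_one fun s hs => ?_
    have hd : deriv P.gibbsPath s = G s := (hπG s hs).deriv
    simp only [HeatEngine.heatRate]
    rw [hd]
  have ha : 0 < P.quasistaticActivity := by
    refine HeatEngine.Protocol.quasistaticActivity_pos hdec' ?_
    -- Without jumps no heat is exchanged, and the quasistatic work vanishes.
    by_contra! h
    refine hwork.ne' (hwork_eq.trans (intervalIntegral.integral_zero_ae ?_))
    refine Eventually.of_forall fun s hs => ?_
    rw [Set.uIoc_of_le zero_le_one] at hs
    rw [hG, HeatEngine.trace_mul_lindbladian (P.H_hermitian s) (ω := fun k => P.ω k s)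
      (fun k => P.energy_change k s)]
    simp [h s (Set.Ioc_subset_Icc_self hs)]
  refine ⟨ha, ?_⟩
  -- The velocities of the eigenvalues.
  have hv : ∀ i, HeatEngine.UniformApprox
      (fun τ s => (((U τ s)ᴴ * P.rescaledRate τ (ρ τ) s * U τ s) i i).re)
      (fun s => (((U' 0 s)ᴴ * G s * U' 0 s) i i).re) := fun i =>
    ((hU.conjTranspose.matrix_mul hg).matrix_mul hU).apply_re i i
  obtain ⟨ℓ, hℓ0, hℓ, hℓle⟩ := hdec'.exists_length
    (hdec'.continuousOn hU.continuousOn P.continuous_gibbsPath.continuousOn)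
    (D := fun s i => (((U' 0 s)ᴴ * G s * U' 0 s) i i).re) (fun i => (hv i).continuousOn)
    (fun i s hs => hdec'.hasDerivAt hU.continuousOn hs (hπG s hs) i)
  refine ⟨ℓ, hℓ, ?_⟩
  obtain ⟨CV, hCV, hVb⟩ := (HeatEngine.UniformApprox.sum Finset.univ
    fun i _ => (hv i).abs).integral
  obtain ⟨CA, hCA, hAb⟩ := (HeatEngine.UniformApprox.sum Finset.univ fun k _ =>
    (((HeatEngine.UniformApprox.const (P.L_continuous k).continuousOn).matrix_mul hR).matrix_mul
      (HeatEngine.UniformApprox.const (P.L_continuous k).continuousOn).conjTranspose).trace_re).integral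
  obtain ⟨CW, hCW, hWb⟩ := ((HeatEngine.UniformApprox.const
    P.H_continuous.continuousOn).matrix_mul hg).trace_re.integral
  rw [← hwork_eq] at hWb
  have hA_eq : P.quasistaticActivity =
      ∫ s in (0 : ℝ)..1, ∑ k, ((P.L k s * P.gibbsPath s * (P.L k s)ᴴ).trace).re := by
    rw [HeatEngine.Protocol.quasistaticActivity, HeatEngine.activity, inv_one, one_mul]
  rw [← hA_eq] at hAb
  set a := P.quasistaticActivity
  set W := P.quasistaticWork
  set V := ∫ s in (0 : ℝ)..1, ∑ i, |(((U' 0 s)ᴴ * G s * U' 0 s) i i).re|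
  have hV0 : 0 ≤ V := by linarith
  -- The states have full rank for large `τ`, uniformly over the cycle.
  have hppos : ∀ᶠ τ in atTop, ∀ i, ∀ s ∈ Set.Icc (0 : ℝ) 1,
      0 < (((U τ s)ᴴ * ρ τ (τ * s) * U τ s) i i).re := by
    rw [eventually_all]
    intro i
    refine (((hU.conjTranspose.matrix_mul hR).matrix_mul hU).apply_re i i).eventually_pos ?_
    intro s hs
    rw [← hdec'.eigenvalue_eq hs i]
    exact hdec'.pos_of_posDef hs (P.gibbsPath_posDef s) i
  -- The multiplier `x = V / a` is optimal for the linearised speed limit of the Gibbs path, where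
  -- it yields `V² / (2 a) ≥ 2 ℓ² / a`.
  set x := V / a with hx
  have hx0 : 0 ≤ x := div_nonneg hV0 ha.le
  set X := 2 * ℓ ^ 2 / a with hXdef
  have hX0 : 0 ≤ X := by positivity
  set C₁ := x * CV + x ^ 2 / 2 * CA with hC₁
  have hC₁0 : 0 ≤ C₁ := by positivity
  have hXV : X ≤ x * V - x ^ 2 / 2 * a := by
    have e : x * V - x ^ 2 / 2 * a = V ^ 2 / 2 / a := by rw [hx]; field_simp; ring
    rw [e, hXdef]
    have : 2 * ℓ ≤ V := by linarith
    gcongr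
    nlinarith
  set C' := 2 * P.Tc * C₁ / W + 2 * P.Tc * X * CW / W ^ 2 + 4 * P.Tc ^ 2 * X ^ 2 / W ^ 2
  have hlimW : Tendsto (fun τ : ℝ => CW / τ) atTop (𝓝 0) := tendsto_const_nhds.div_atTop tendsto_id
  have hfinal : ∀ᶠ τ in atTop, 0 < P.meanHeat τ (ρ τ) ∧
      P.efficiency τ (ρ τ) ≤
        P.carnot * (1 - 2 * P.Tc / a * (ℓ ^ 2 / (W * τ))) + P.carnot * C' / τ ^ 2 := by
    filter_upwards [hVb, hAb, hWb, hev, hppos, eventually_gt_atTop 0,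
      hlimW.eventually_lt_const (half_pos hwork)] with τ hV hA hw hdec hpos hτ hsmall
    have hcyc := hρ τ hτ
    have hpτ : ∀ s ∈ Set.Icc (0 : ℝ) 1, ∀ i, 0 < p τ s i := by
      intro s hs i
      rw [hdec.1.eigenvalue_eq hs i]
      exact hpos i s hs
    have hsl := fun {x : ℝ} (hx : 0 ≤ x) => hcyc.cycle_speed_limit hτ hdec.1 hdec.2 hpτ hx
    set w := ∫ s in (0 : ℝ)..1, ((P.H s * P.rescaledRate τ (ρ τ) s).trace).re
    set j := ∫ s in (0 : ℝ)..1, P.α s * ((P.H s * P.rescaledRate τ (ρ τ) s).trace).re with hj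
    set y := -(τ * ∫ s in (0 : ℝ)..1,
      (P.temp s)⁻¹ * ((P.H s * P.rescaledRate τ (ρ τ) s).trace).re) with hy
    have hqc : Continuous fun s => ((P.H s * P.rescaledRate τ (ρ τ) s).trace).re :=
      Complex.continuous_re.comp
        (P.H_continuous.matrix_mul hcyc.continuous_rescaledRate).matrix_trace
    -- Carnot's relation between work, heat and entropy production.
    have hbal : P.carnot * j = w + P.Tc * y * τ⁻¹ := by
      have e : ∫ s in (0 : ℝ)..1,
          (P.temp s)⁻¹ * ((P.H s * P.rescaledRate τ (ρ τ) s).trace).re =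
          P.Tc⁻¹ * (w - P.carnot * j) := by
        have hαc : Continuous fun s =>
            P.carnot * (P.α s * ((P.H s * P.rescaledRate τ (ρ τ) s).trace).re) :=
          continuous_const.mul (P.α_continuous.mul hqc)
        rw [hj, ← intervalIntegral.integral_const_mul, ← intervalIntegral.integral_sub
          (hqc.intervalIntegrable _ _) (hαc.intervalIntegrable _ _),
          ← intervalIntegral.integral_const_mul]
        refine intervalIntegral.integral_congr fun s _ => ?_
        simp only [P.inv_temp]
        ring
      have hTc := P.Tc_pos.ne'
      rw [hy, e]
      field_simp
      ring
    have hy0 : 0 ≤ y := by simpa using hsl le_rfl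
    have hyX : X - C₁ * τ⁻¹ ≤ y := by
      refine le_trans ?_ (hsl hx0)
      have h1 := mul_le_mul_of_nonneg_left (abs_le.1 hV).1 hx0
      have h2 := mul_le_mul_of_nonneg_left (abs_le.1 hA).2 (by positivity : 0 ≤ x ^ 2 / 2)
      have e1 : C₁ * τ⁻¹ = x * (CV / τ) + x ^ 2 / 2 * (CA / τ) := by rw [hC₁]; ring
      rw [e1]
      linarith
    have hwW : W / 2 ≤ w := by linarith [(abs_le.1 hw).1]
    have hw0 : 0 < w := (half_pos hwork).trans_le hwW
    have hη := P.carnot_pos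
    have hTc := P.Tc_pos
    have hden : 0 < w + P.Tc * y * τ⁻¹ := by positivity
    have hj0 : 0 < j := by
      rw [← hbal] at hden
      exact pos_of_mul_pos_right hden hη.le
    refine ⟨by rw [hcyc.meanHeat_eq hτ]; positivity, ?_⟩
    have heff : P.efficiency τ (ρ τ) = P.carnot * (w / (w + P.Tc * y * τ⁻¹)) := by
      rw [HeatEngine.Protocol.efficiency, hcyc.workPower_eq hτ, hcyc.meanHeat_eq hτ,
        mul_div_mul_left _ _ (inv_pos.2 hτ).ne', ← hbal, mul_div_assoc',
        mul_div_mul_left _ _ hη.ne']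
    have hbound := HeatEngine.div_add_le_of_approx hwork hTc hX0 hC₁0 (inv_pos.2 hτ).le
      (by rwa [← div_eq_mul_inv]) hyX hy0 hwW
    rw [heff]
    refine (mul_le_mul_of_nonneg_left hbound hη.le).trans (le_of_eq ?_)
    rw [hXdef]
    ring
  obtain ⟨τ₁, hτ₁⟩ := eventually_atTop.1 hfinal
  exact ⟨P.carnot * C', max τ₁ 1, by positivity, fun τ hτ => hτ₁ τ ((le_max_left _ _).trans hτ)⟩
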